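/- Let $\alpha\ge 0$. Let $T$ be a BGW$(2,1/2)$ tree, i.e. the family tree of a Galton–Watson process with offspring distribution $\mathrm{Bin}(2,1/2)$, and let cars arrive at its vertices, the numbers of cars arriving at the different vertices being independent $\mathrm{Po}(\alpha)$ random variables, independent of $T$. Every vertex is a parking space for one car. The cars arrive one by one, in any order; each car drives from its arrival vertex along the path towards the root and parks at the first free vertex that it meets (its arrival vertex included), and it leaves the tree through the root if there is none. Let $X$ be the number of cars that visit the root (whether they park there or leave through it), let $p=\mathbb P(X=0)$, and let $G(s)=\mathbb E[s^X]$, $s\in[0,1]$. 1. If $0\le\alpha\le 2-\sqrt2$, then for all $s\in[0,1]$ $$G(s)=1-\alpha-s(2-\alpha)+2s^2e^{\alpha(1-s)}+2s\,e^{\alpha(1-s)}\sqrt{s^2-e^{\alpha(s-1)}\bigl(s(2-\alpha)-(1-\alpha)\bigr)},$$ where the radicand is non-negative. Furthermore $p=1-\alpha$, and $\mathbb E[X]=2-\alpha-\sqrt{2(\alpha^2-4\alpha+2)}$, which is finite. 2. If $\alpha>2-\sqrt2$, put $$s_p=\frac{1+(1+\alpha)p-\sqrt{(1+(1+\alpha)p)^2-8\alpha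 p(1+p)}}{2\alpha(1+p)},\qquad g(s)=s^2-e^{\alpha(s-1)}\bigl(s(1+p)-p\bigr).$$ Then the radicand in $s_p$ is non-negative, $0<s_p<1$, $g\ge0$ on $[0,1]$, and $$G(s)=p-s(1+p)+2s^2e^{\alpha(1-s)}+\begin{cases}2s\,e^{\alpha(1-s)}\sqrt{g(s)},&0\le s\le s_p,\\-2s\,e^{\alpha(1-s)}\sqrt{g(s)},&s_p<s\le1.\end{cases}$$ Furthermore $p>1-\alpha$ and $\mathbb E[X]=\infty$. 3. If $\alpha>2-\sqrt2$, then $\max\bigl(e^{-\alpha}/4,\;1-\alpha\bigr)<p<c(\alpha)$, where $$c(\alpha)=\begin{cases}\dfrac{(3-2\sqrt2)\alpha-1}{\alpha^2-6\alpha+1},&\alpha\ne3+2\sqrt2,\\[2mm]\dfrac{3\sqrt2-4}{8},&\alpha=3+2\sqrt2.\end{cases}$$ -/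

import Mathlib

/-- The infinite vertex set `⋃ₙ {1, 2}ⁿ`. The child labels `1, 2` are the elements `0, 1` of `Fin 2`,
and words are written with their last letter first: `i :: v` is the child of `v` with label `i`,
`v` is the parent of `i :: v`, and `[]` is the root. -/
abbrev Vertex : Type := List (Fin 2)

/-- Membership in the family tree in which a vertex `v` has `c v` children: the root belongs to it,
and a child `i :: v` (with `i` counted from `0`) belongs to it iff `v` does and `i < c v`. -/
def InFamilyTree (c : Vertex → ℕ) : Vertex → Prop
  | [] => True
  | i :: v => InFamilyTree c v ∧ (i : ℕ) < c v

/-- The rooted binary tree in which `v` has `c v` children. When the `c v` are independent with law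
`Bin(2, 1/2)`, this is the BGW(2, 1/2) tree. -/
def familyTree (c : Vertex → ℕ) : Set Vertex := {v | InFamilyTree c v}

/-- The space in which a car arriving at a vertex parks, given the set `S` of occupied vertices: the
first free vertex on the path to the root; `none` if the car leaves through the root. -/
def parkingSpace (S : Finset Vertex) : Vertex → Option Vertex
  | [] => if [] ∈ S then none else some []
  | i :: v => if i :: v ∈ S then parkingSpace S v else some (i :: v)

/-- The state of the parking process: the set of occupied vertices, and the number of cars that
have visited the root so far (those that parked there and those that left through it). -/
structure ParkingState where
  occupied : Finset Vertex
  rootVisits : ℕ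

/-- One car arrives at `v`, drives towards the root, and parks or leaves. -/
def ParkingState.step (σ : ParkingState) (v : Vertex) : ParkingState :=
  match parkingSpace σ.occupied v with
  | none => ⟨σ.occupied, σ.rootVisits + 1⟩
  | some u => ⟨insert u σ.occupied, if u = [] then σ.rootVisits + 1 else σ.rootVisits⟩

/-- The number of cars that visit the root when cars arrive one after the other at the vertices
listed in `L`, all vertices being free at the start. -/
def rootVisits (L : List Vertex) : ℕ :=
  (L.foldl ParkingState.step ⟨∅, 0⟩).rootVisits

/-- `L` lists the arrival vertices, in some order, of the cars on the tree `t`, where `a v` cars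
arrive at the vertex `v` of `t`. -/
def IsArrivalSequence (t : Set Vertex) (a : Vertex → ℕ) (L : List Vertex) : Prop :=
  ∀ v, (v ∈ t → L.count v = a v) ∧ (v ∉ t → L.count v = 0)

noncomputable section

/-- The radicand `s² - e^{α(s-1)} (s(1+p) - p)`. -/
def radicand (α p s : ℝ) : ℝ :=
  s ^ 2 - Real.exp (α * (s - 1)) * (s * (1 + p) - p)

/-- The discriminant `(1 + (1+α)p)² - 8αp(1+p)`. -/
def switchDiscrim (α p : ℝ) : ℝ :=
  (1 + (1 + α) * p) ^ 2 - 8 * α * p * (1 + p)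

/-- The switch point `s_p`. -/
def switchPoint (α p : ℝ) : ℝ :=
  (1 + (1 + α) * p - √(switchDiscrim α p)) / (2 * α * (1 + p))

/-- The upper bound `c(α)` for `p`. -/
def upperBound (α : ℝ) : ℝ :=
  if α = 3 + 2 * √2 then (3 * √2 - 4) / 8
  else ((3 - 2 * √2) * α - 1) / (α ^ 2 - 6 * α + 1)

end

/-!
The number of cars visiting a vertex does not depend on the order of arrival: after any arrivals,
the occupied vertices are the visited ones, and each vertex is visited by its own cars and by all
but one of the cars visiting each of its children (`exists_flowConsistent`). On a finite tree
these relations determine the numbers of visits recursively (`rootVisits_eq_visits`), and the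
critical tree is finite almost surely (`ae_exists_diesOut`). Since the subtrees above the children
of the root are independent copies of the whole tree, `G s = E[s ^ X]` and `H s = E[s ^ (X - 1)⁺]`
satisfy `G s = e^{α (s - 1)} ((1 + H s) / 2) ^ 2` (`integral_pow_eq`), while `s * H s = G s - p +
s * p`. This is a quadratic equation for `H`. It says that `F s = (1 + H s) / 2 * e^{α (s - 1)} -
s` (`signedRoot`) is a square root of the radicand `g`, and `G` is an explicit function of `F`.

It remains to find the sign of `F` and the number `p`. As `g ≥ 0`, `g 1 = 0` and `g' 1 = 1 - α -
p`, we have `p ≥ 1 - α`. Suppose that `p > 1 - α`. Near `1` the square of `F` is then of first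
order, while `F s ≤ 1 - s`, so `F` is negative somewhere near `1`; as `F 0 > 0`, it has a zero in
`(0, 1)`. There `g` has a double zero; eliminating the exponential from `g = g' = 0` leaves the
quadratic equation `switchPoly α p s = 0`. The monotonicity of `2 log s - α (s - 1) - log (s (1 +
p) - p)` excludes the larger root (`interior_zero_bounds`), so the switch point, which is the
smaller root, is the only zero. The location of the roots and the positivity of the discriminant,
which factors over `ℚ(√2)`, give `α > 2 - √2` and the upper bound for `p` (`lt_upperBound`). If on
the other hand `p = 1 - α > 0`, then `g'' 1 = α ^ 2 - 4 * α + 2 ≥ 0`, which together force `α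
≤ 2 - √2`, and the other root of `switchPoly` lies outside `(0, 1)`, so that `F` is positive
there.

The mean of `X` is the limit of `(1 - G s) / (1 - s)` at `1`. For `p = 1 - α` it follows from the
second-order expansion of `g`; for `p > 1 - α` it is infinite, because `g` is of first order and
hence `1 - G` is not.
-/

open MeasureTheory ProbabilityTheory Filter Topology

/-! ### Parking on a finite tree does not depend on the order of arrival -/

/-- The number of visits to `v` when the tree below `v` is cut after `n` generations (the first of
which is `v` itself): `v` is visited by its own cars, and by all but one of the cars that visit each
of its children. Here `v` has `c v` children and `a v` cars arrive at it. -/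
def visits (c a : Vertex → ℕ) : ℕ → Vertex → ℕ
  | 0, _ => 0
  | n + 1, v => a v + ∑ i : Fin 2, if (i : ℕ) < c v then visits c a n (i :: v) - 1 else 0

/-- `1` if the progeny of `v` dies out within `n` generations (counting `v` itself), else `0`. -/
def diesOut (c : Vertex → ℕ) : ℕ → Vertex → ℕ
  | 0, _ => 0
  | n + 1, v => ∏ i : Fin 2, if (i : ℕ) < c v then diesOut c n (i :: v) else 1

/-- The occupied set `S` and the numbers of visits `k v` to the vertices `v` are compatible with the
numbers of arrivals `a v`: the occupied vertices are those visited, and of the cars visiting a child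
all but one drive on to its parent. -/
def FlowConsistent (S : Finset Vertex) (k a : Vertex → ℕ) : Prop :=
  (∀ v, v ∈ S ↔ 1 ≤ k v) ∧ ∀ v, k v = a v + ∑ i : Fin 2, (k (i :: v) - 1)

/-- An arrival keeps the flow consistent: the visits increase along the path driven by the car. -/
lemma FlowConsistent.step (v : Vertex) :
    ∀ {S : Finset Vertex} {k a : Vertex → ℕ}, FlowConsistent S k a → ∀ r : ℕ, r = k [] →
      ∃ k', FlowConsistent (ParkingState.step ⟨S, r⟩ v).occupied k' (a + Pi.single v 1) ∧
        (ParkingState.step ⟨S, r⟩ v).rootVisits = k' [] ∧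
        S ⊆ (ParkingState.step ⟨S, r⟩ v).occupied := by
  induction v with
  | nil =>
    intro S k a h r hr
    by_cases hS : ([] : Vertex) ∈ S
    · have e : ParkingState.step ⟨S, r⟩ [] = ⟨S, r + 1⟩ := by
        simp [ParkingState.step, parkingSpace, hS]
      rw [e]
      refine ⟨k + Pi.single [] 1, ⟨fun v => ?_, fun v => ?_⟩, by simp [hr], subset_rfl⟩
      · by_cases hv : v = []
        · simp [hv, hS]
        · simp [hv, h.1 v]
      · have := h.2 v
        simp only [Pi.add_apply, ne_eq, reduceCtorEq, not_false_eq_true, Pi.single_eq_of_ne,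
          add_zero]
        omega
    · have e : ParkingState.step ⟨S, r⟩ [] = ⟨insert [] S, r + 1⟩ := by
        simp [ParkingState.step, parkingSpace, hS]
      rw [e]
      refine ⟨k + Pi.single [] 1, ⟨fun v => ?_, fun v => ?_⟩, by simp [hr], by simp⟩
      · by_cases hv : v = []
        · simp [hv]
        · simp [hv, h.1 v]
      · have := h.2 v
        simp only [Pi.add_apply, ne_eq, reduceCtorEq, not_false_eq_true, Pi.single_eq_of_ne,
          add_zero]
        omega
  | cons i w ih =>
    intro S k a h r hr
    by_cases hS : i :: w ∈ S
    -- the space is taken, so the car behaves as if it had arrived at the parent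
    · have e : ParkingState.step ⟨S, r⟩ (i :: w) = ParkingState.step ⟨S, r⟩ w := by
        simp [ParkingState.step, parkingSpace, hS]
      rw [e]
      obtain ⟨k', h1, h2, h3⟩ := ih h r hr
      have hk : 1 ≤ k' (i :: w) := (h1.1 _).1 (h3 hS)
      refine ⟨k' + Pi.single (i :: w) 1, ⟨fun v => ?_, fun v => ?_⟩, by simp [h2], h3⟩
      · by_cases hv : v = i :: w
        · simp [hv, h3 hS]
        · simp [hv, h1.1 v]
      · have hv := h1.2 v
        by_cases h4 : v = w
        · subst h4
          have h6 : ∀ j : Fin 2, (k' + Pi.single (i :: v) 1 : Vertex → ℕ) (j :: v) - 1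
              = (k' (j :: v) - 1) + if j = i then 1 else 0 := by
            intro j
            by_cases hj : j = i
            · subst hj; simp only [Pi.add_apply, Pi.single_eq_same, if_true]; omega
            · simp [hj]
          have h7 : (v : Vertex) ≠ i :: v := by simp
          simp only [h6, Finset.sum_add_distrib]
          simp only [Pi.add_apply, Pi.single_eq_same, Pi.single_eq_of_ne h7] at hv ⊢
          simp only [Finset.sum_ite_eq', Finset.mem_univ, if_true]
          omega
        · have h6 : ∀ j : Fin 2,
              (k' + Pi.single (i :: w) 1 : Vertex → ℕ) (j :: v) = k' (j :: v) := by
            intro j; simp [h4]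
          simp only [h6]
          simp only [Pi.add_apply, Pi.single_eq_of_ne h4] at hv ⊢
          omega
    · have e : ParkingState.step ⟨S, r⟩ (i :: w) = ⟨insert (i :: w) S, r⟩ := by
        simp [ParkingState.step, parkingSpace, hS]
      rw [e]
      have hk : k (i :: w) = 0 := by
        have := h.1 (i :: w)
        by_contra hne
        exact hS (this.2 (by omega))
      refine ⟨k + Pi.single (i :: w) 1, ⟨fun v => ?_, fun v => ?_⟩, by simp [hr], by simp⟩
      · by_cases hv : v = i :: w
        · simp [hv]
        · simp [hv, h.1 v]
      · have hv := h.2 v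
        -- the single car at the newly occupied vertex is not passed on to its parent
        have h6 : ∀ j : Fin 2,
            (k + Pi.single (i :: w) 1 : Vertex → ℕ) (j :: v) - 1 = k (j :: v) - 1 := by
          intro j
          by_cases hj : j :: v = i :: w
          · rw [hj]; simp [hk]
          · simp [hj]
        simp only [h6]
        simp only [Pi.add_apply]
        omega

/-- The state after any list of arrivals is described by a consistent flow. -/
lemma exists_flowConsistent (L : List Vertex) :
    ∃ k, FlowConsistent (L.foldl ParkingState.step ⟨∅, 0⟩).occupied k (fun v => L.count v) ∧
      rootVisits L = k [] := by
  induction L using List.reverseRecOn with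
  | nil => exact ⟨0, ⟨by simp, by simp⟩, rfl⟩
  | append_singleton L v ih =>
    obtain ⟨k, h, hr⟩ := ih
    obtain ⟨k', h1, h2, -⟩ := h.step v _ hr
    refine ⟨k', ?_, ?_⟩
    · rw [List.foldl_append]
      have e : (fun u => (L ++ [v]).count u) = (fun u => L.count u) + Pi.single v 1 := by
        funext u
        by_cases huv : u = v
        · simp [huv]
        · simp [huv, Ne.symm huv]
      rw [e]
      exact h1
    · simpa [rootVisits, List.foldl_append] using h2

/-- A vertex below which no car arrives is not visited. -/
lemma FlowConsistent.eq_zero {S : Finset Vertex} {k a : Vertex → ℕ} (h : FlowConsistent S k a)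
    {v : Vertex} (hv : ∀ u, a (u ++ v) = 0) : k v = 0 := by
  obtain ⟨M, hM⟩ : ∃ M, ∀ w ∈ S, w.length < M :=
    ⟨S.sup List.length + 1, fun w hw => Nat.lt_succ_of_le (Finset.le_sup (f := List.length) hw)⟩
  have key : ∀ d : ℕ, ∀ w : Vertex, (∀ u, a (u ++ w) = 0) → M ≤ w.length + d → k w = 0 := by
    intro d
    induction d with
    | zero =>
      intro w _ hl
      by_contra hne
      have := hM w ((h.1 w).2 (by omega))
      omega
    | succ d ih =>
      intro w hw hl
      have h0 : a w = 0 := hw []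
      have h1 : ∀ i : Fin 2, k (i :: w) = 0 := fun i =>
        ih (i :: w) (fun u => by simpa using hw (u ++ [i])) (by simp; omega)
      rw [h.2 w]
      simp [h0, h1]
  exact key M v hv (by omega)

/-- Ancestors of vertices of the family tree belong to it. -/
lemma inFamilyTree_of_append {c : Vertex → ℕ} {v : Vertex} :
    ∀ u : Vertex, InFamilyTree c (u ++ v) → InFamilyTree c v
  | [], h => h
  | _ :: u, h => inFamilyTree_of_append u h.1

/-- On a tree of fewer than `m` generations below the root, every arrival order leads to
`visits c a m []` visits to the root. -/
theorem rootVisits_eq_visits {c a : Vertex → ℕ} {L : List Vertex} {m : ℕ}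
    (hm : ∀ v, InFamilyTree c v → v.length < m) (hL : IsArrivalSequence (familyTree c) a L) :
    rootVisits L = visits c a m [] := by
  obtain ⟨k, h, hr⟩ := exists_flowConsistent L
  rw [hr]
  have out : ∀ v, ¬ InFamilyTree c v → k v = 0 := fun v hv =>
    h.eq_zero fun u => (hL (u ++ v)).2 fun hu => hv (inFamilyTree_of_append u hu)
  have key : ∀ d : ℕ, ∀ v : Vertex, InFamilyTree c v → m ≤ v.length + d →
      k v = visits c a d v := by
    intro d
    induction d with
    | zero => intro v hv hl; have := hm v hv; omega
    | succ d ih =>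
      intro v hv hl
      have hLv : L.count v = a v := (hL v).1 hv
      rw [h.2 v, visits]
      refine congrArg₂ (· + ·) hLv ?_
      refine Finset.sum_congr rfl fun i _ => ?_
      split_ifs with hi
      · rw [ih (i :: v) ⟨hv, hi⟩ (by simp; omega)]
      · rw [out (i :: v) fun hc => hi hc.2]
  exact key m [] trivial (by simp)

/-- If the progeny of the root dies out within `n` generations, all vertices are at depth less
than `n`. -/
lemma length_lt_of_diesOut {c : Vertex → ℕ} {n : ℕ} (h : diesOut c n [] ≠ 0) (w : Vertex)
    (hw : InFamilyTree c w) : w.length < n := by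
  have key : ∀ m : ℕ, ∀ u v : Vertex, InFamilyTree c (u ++ v) → m ≤ u.length →
      diesOut c m v = 0 := by
    intro m
    induction m with
    | zero => intro u v _ _; rfl
    | succ m ih =>
      intro u v huv hl
      obtain ⟨u', i, rfl⟩ := (List.eq_nil_or_concat' u).resolve_left (by rintro rfl; simp at hl)
      rw [List.append_assoc, List.singleton_append] at huv
      have hc : (i : ℕ) < c v := (inFamilyTree_of_append u' huv).2
      rw [diesOut]
      refine Finset.prod_eq_zero (Finset.mem_univ i) ?_
      rw [if_pos hc]
      exact ih u' (i :: v) huv (by simp at hl; omega)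
  by_contra hlt
  exact h (key n w [] (by simpa using hw) (by omega))

lemma diesOut_le_one (c : Vertex → ℕ) (n : ℕ) (v : Vertex) : diesOut c n v ≤ 1 := by
  induction n generalizing v with
  | zero => simp [diesOut]
  | succ n ih =>
    rw [diesOut]
    refine Finset.prod_le_one' fun i _ => ?_
    split_ifs
    · exact ih _
    · exact le_rfl

/-- If the family tree dies out, it is finite and every arrival order leads to the same number of
visits to the root, given by the recursion for all large heights. -/
theorem rootVisits_eq_visits_of_diesOut {c a : Vertex → ℕ} {n : ℕ} (h : diesOut c n [] ≠ 0)
    {L : List Vertex}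
    (hL : (familyTree c).Finite → IsArrivalSequence (familyTree c) a L) {m : ℕ} (hm : n ≤ m) :
    rootVisits L = visits c a m [] := by
  refine rootVisits_eq_visits (fun v hv => (length_lt_of_diesOut h v hv).trans_le hm) (hL ?_)
  exact (List.finite_length_lt (Fin 2) n).subset fun v hv => length_lt_of_diesOut h v hv

/-! ### Independence of the subtrees -/

lemma measurable_discrete_combination {Ω : Type*} {m : MeasurableSpace Ω} {x y z w : Ω → ℕ}
    (Φ : ℕ → ℕ → ℕ → ℕ → ℕ) (hx : Measurable x) (hy : Measurable y) (hz : Measurable z)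
    (hw : Measurable w) : Measurable fun ω => Φ (x ω) (y ω) (z ω) (w ω) :=
  (Measurable.of_discrete (f := fun p : ℕ × ℕ × ℕ × ℕ => Φ p.1 p.2.1 p.2.2.1 p.2.2.2)).comp
    (hx.prodMk (hy.prodMk (hz.prodMk hw)))

/-- The σ-algebra of the numbers of children (left summand) and of cars (right summand) whose
indices lie in `S`. -/
@[reducible] def marksSigma {Ω : Type*} (N A : Vertex → Ω → ℕ) (S : Set (Vertex ⊕ Vertex)) :
    MeasurableSpace Ω :=
  ⨆ x ∈ S, MeasurableSpace.comap (Sum.elim N A x) ⊤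

/-- The indices of the marks carried by the descendants of `v`, including `v`. -/
def descendantMarks (v : Vertex) : Set (Vertex ⊕ Vertex) :=
  {x | v <:+ x.elim id id}

section Marks

variable {Ω : Type*} {N A : Vertex → Ω → ℕ}

lemma marksSigma_mono {S T : Set (Vertex ⊕ Vertex)} (h : S ⊆ T) :
    marksSigma N A S ≤ marksSigma N A T :=
  biSup_mono h

lemma measurable_mark {S : Set (Vertex ⊕ Vertex)} {x : Vertex ⊕ Vertex} (hx : x ∈ S) :
    Measurable[marksSigma N A S] (Sum.elim N A x) :=
  measurable_iff_comap_le.2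
    (le_biSup (f := fun x => MeasurableSpace.comap (Sum.elim N A x) ⊤) hx)

lemma descendantMarks_cons_subset (i : Fin 2) (v : Vertex) :
    descendantMarks (i :: v) ⊆ descendantMarks v :=
  fun _ hx => (List.suffix_cons i v).trans hx

lemma measurable_visits (n : ℕ) (v : Vertex) :
    Measurable[marksSigma N A (descendantMarks v)]
      fun ω => visits (fun u => N u ω) (fun u => A u ω) n v := by
  induction n generalizing v with
  | zero => exact @measurable_const _ _ _ (_) _
  | succ n ih =>
    have hA : Measurable[marksSigma N A (descendantMarks v)] (A v) :=
      measurable_mark (x := Sum.inr v) (by simp [descendantMarks])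
    have hN : Measurable[marksSigma N A (descendantMarks v)] (N v) :=
      measurable_mark (x := Sum.inl v) (by simp [descendantMarks])
    have hY : ∀ i : Fin 2, Measurable[marksSigma N A (descendantMarks v)]
        fun ω => visits (fun u => N u ω) (fun u => A u ω) n (i :: v) := fun i =>
      (ih (i :: v)).mono (marksSigma_mono (descendantMarks_cons_subset i v)) le_rfl
    simp only [visits, Fin.sum_univ_two]
    exact measurable_discrete_combination
      (fun a c y z => a + ((if ((0 : Fin 2) : ℕ) < c then y - 1 else 0) +
        if ((1 : Fin 2) : ℕ) < c then z - 1 else 0)) hA hN (hY 0) (hY 1)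

lemma measurable_diesOut (n : ℕ) (v : Vertex) :
    Measurable[marksSigma N A (descendantMarks v)] fun ω => diesOut (fun u => N u ω) n v := by
  induction n generalizing v with
  | zero => exact @measurable_const _ _ _ (_) _
  | succ n ih =>
    have hN : Measurable[marksSigma N A (descendantMarks v)] (N v) :=
      measurable_mark (x := Sum.inl v) (by simp [descendantMarks])
    have hY : ∀ i : Fin 2, Measurable[marksSigma N A (descendantMarks v)]
        fun ω => diesOut (fun u => N u ω) n (i :: v) := fun i =>
      (ih (i :: v)).mono (marksSigma_mono (descendantMarks_cons_subset i v)) le_rfl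
    simp only [diesOut, Fin.prod_univ_two]
    exact measurable_discrete_combination
      (fun _ c y z => (if ((0 : Fin 2) : ℕ) < c then y else 1) *
        if ((1 : Fin 2) : ℕ) < c then z else 1) hN hN (hY 0) (hY 1)

lemma disjoint_inl_descendantMarks (v : Vertex) :
    Disjoint {Sum.inl v}
      (descendantMarks ((0 : Fin 2) :: v) ∪ descendantMarks ((1 : Fin 2) :: v)) := by
  rw [Set.disjoint_singleton_left]
  rintro (h | h) <;>
    · have := List.IsSuffix.length_le h
      simp at this

lemma disjoint_inr_descendantMarks (v : Vertex) :
    Disjoint {Sum.inr v} ({Sum.inl v} ∪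
      (descendantMarks ((0 : Fin 2) :: v) ∪ descendantMarks ((1 : Fin 2) :: v))) := by
  rw [Set.disjoint_singleton_left]
  rintro (h | h | h)
  · simp at h
  all_goals
    have := List.IsSuffix.length_le h
    simp at this

lemma disjoint_descendantMarks (v : Vertex) :
    Disjoint (descendantMarks ((0 : Fin 2) :: v)) (descendantMarks ((1 : Fin 2) :: v)) := by
  rw [Set.disjoint_left]
  intro x h0 h1
  have := (List.suffix_of_suffix_length_le h0 h1 (by simp)).eq_of_length (by simp)
  simp at this

variable [MeasurableSpace Ω] {μ : Measure Ω}

lemma marksSigma_le (hN : ∀ v, Measurable (N v)) (hA : ∀ v, Measurable (A v))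
    (S : Set (Vertex ⊕ Vertex)) : marksSigma N A S ≤ ‹MeasurableSpace Ω› := by
  refine iSup₂_le fun x _ => ?_
  cases x with
  | inl v => exact (hN v).comap_le
  | inr v => exact (hA v).comap_le

lemma indepFun_of_disjoint (hN : ∀ v, Measurable (N v)) (hA : ∀ v, Measurable (A v))
    (hindep : iIndepFun (Sum.elim N A) μ) {S T : Set (Vertex ⊕ Vertex)} (hST : Disjoint S T)
    {β γ : Type*} [MeasurableSpace β] [MeasurableSpace γ] {F : Ω → β} {G : Ω → γ}
    (hF : Measurable[marksSigma N A S] F) (hG : Measurable[marksSigma N A T] G) :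
    IndepFun F G μ := by
  have h : Indep (marksSigma N A S) (marksSigma N A T) μ := by
    refine indep_iSup_of_disjoint (fun x => ?_) hindep hST
    cases x with
    | inl v => exact (hN v).comap_le
    | inr v => exact (hA v).comap_le
  exact indep_of_indep_of_le_left (indep_of_indep_of_le_right h hG.comap_le) hF.comap_le

/-- The cars and the number of children of `v`, and functionals of the subtrees of its two
possible children, are independent. -/
lemma indepFun_subtrees (hN : ∀ v, Measurable (N v)) (hA : ∀ v, Measurable (A v))
    (hindep : iIndepFun (Sum.elim N A) μ) (v : Vertex)
    {β : Type*} [MeasurableSpace β] {Z : Fin 2 → Ω → β}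
    (hZ : ∀ i, Measurable[marksSigma N A (descendantMarks (i :: v))] (Z i)) :
    IndepFun (A v) (fun ω => (N v ω, Z 0 ω, Z 1 ω)) μ ∧
      IndepFun (N v) (fun ω => (Z 0 ω, Z 1 ω)) μ ∧ IndepFun (Z 0) (Z 1) μ := by
  have hZZ : Measurable[marksSigma N A (descendantMarks ((0 : Fin 2) :: v) ∪
      descendantMarks ((1 : Fin 2) :: v))] fun ω => (Z 0 ω, Z 1 ω) :=
    @Measurable.prodMk _ _ _ _ _ (_) _ _
      ((hZ 0).mono (marksSigma_mono Set.subset_union_left) le_rfl)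
      ((hZ 1).mono (marksSigma_mono Set.subset_union_right) le_rfl)
  have hNZ : Measurable[marksSigma N A ({Sum.inl v} ∪ (descendantMarks ((0 : Fin 2) :: v) ∪
      descendantMarks ((1 : Fin 2) :: v)))] fun ω => (N v ω, Z 0 ω, Z 1 ω) :=
    @Measurable.prodMk _ _ _ _ _ (_) _ _
      (measurable_mark (x := Sum.inl v) (by simp))
      (hZZ.mono (marksSigma_mono Set.subset_union_right) le_rfl)
  refine ⟨?_, ?_, ?_⟩
  · exact indepFun_of_disjoint hN hA hindep (disjoint_inr_descendantMarks v)
      (measurable_mark (x := Sum.inr v) (Set.mem_singleton _)) hNZ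
  · exact indepFun_of_disjoint hN hA hindep (disjoint_inl_descendantMarks v)
      (measurable_mark (x := Sum.inl v) (Set.mem_singleton _)) hZZ
  · exact indepFun_of_disjoint hN hA hindep (disjoint_descendantMarks v) (hZ 0) (hZ 1)

variable [IsProbabilityMeasure μ]

/-- The law of the number of visits is the same at all vertices. -/
lemma exists_hasLaw_visits {P Q : Measure ℕ} [IsProbabilityMeasure P] [IsProbabilityMeasure Q]
    (hN : ∀ v, Measurable (N v)) (hA : ∀ v, Measurable (A v))
    (hNlaw : ∀ v, HasLaw (N v) P μ) (hAlaw : ∀ v, HasLaw (A v) Q μ)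
    (hindep : iIndepFun (Sum.elim N A) μ) (n : ℕ) :
    ∃ ν : Measure ℕ, ∀ v,
      HasLaw (fun ω => visits (fun u => N u ω) (fun u => A u ω) n v) ν μ := by
  induction n with
  | zero => exact ⟨Measure.dirac 0, fun v => hasLaw_dirac_of_ae_eq (by simp [visits])⟩
  | succ n ih =>
    obtain ⟨ν, hν⟩ := ih
    have : IsProbabilityMeasure ν := (hν []).isProbabilityMeasure_iff.1 inferInstance
    let Φ : ℕ × ℕ × ℕ × ℕ → ℕ := fun x => x.1 + ((if 0 < x.2.1 then x.2.2.1 - 1 else 0) +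
      if 1 < x.2.1 then x.2.2.2 - 1 else 0)
    refine ⟨(Q.prod (P.prod (ν.prod ν))).map Φ, fun v => ?_⟩
    obtain ⟨h1, h2, h3⟩ := indepFun_subtrees hN hA hindep v
      (Z := fun i ω => visits (fun u => N u ω) (fun u => A u ω) n (i :: v))
      (fun i => measurable_visits n (i :: v))
    have e3 := (indepFun_iff_hasLaw_prodMk_prod (hν _) (hν _)).1 h3
    have e2 := (indepFun_iff_hasLaw_prodMk_prod (hNlaw v) e3).1 h2
    have e1 := (indepFun_iff_hasLaw_prodMk_prod (hAlaw v) e2).1 h1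
    have hΦ : HasLaw Φ ((Q.prod (P.prod (ν.prod ν))).map Φ) (Q.prod (P.prod (ν.prod ν))) :=
      ⟨Measurable.of_discrete.aemeasurable, rfl⟩
    refine (hΦ.comp e1).congr (ae_of_all _ fun ω => ?_)
    simp [visits, Φ, Fin.sum_univ_two]

end Marks

/-! ### The recursive equation for the generating function -/

section Recursion

variable {Ω : Type*} [MeasurableSpace Ω] {μ : Measure Ω} {N A : Vertex → Ω → ℕ}

/-- The offspring law of the tree. -/
noncomputable abbrev offspringLaw : Measure ℕ :=
  binomial 2 ⟨1 / 2, by norm_num, by norm_num⟩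

lemma integral_single_offspring {M : Ω → ℕ} (hM : HasLaw M offspringLaw μ) (k : ℕ) :
    ∫ ω, (Pi.single k 1 : ℕ → ℝ) (M ω) ∂μ = (Nat.choose 2 k : ℝ) / 4 := by
  have := hM.integral_comp (f := (Pi.single k 1 : ℕ → ℝ)) (by fun_prop)
  simp only [Function.comp_def] at this
  rw [this, integral_binomial]
  rcases Nat.lt_or_ge 2 k with hk | hk
  · rw [Nat.choose_eq_zero_of_lt hk]
    refine (Finset.sum_eq_zero fun j hj => ?_).trans (by simp)
    rw [Pi.single_eq_of_ne (by simp at hj; omega)]; simp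
  · rw [Finset.sum_eq_single k]
    · interval_cases k <;> norm_num
    · intro j _ hj; simp [hj]
    · intro h; exact absurd (Finset.mem_Iic.2 hk) h

lemma integral_pow_poisson {M : Ω → ℕ} {α : NNReal} (hM : HasLaw M (poissonMeasure α) μ) (s : ℝ) :
    ∫ ω, s ^ M ω ∂μ = Real.exp (α * (s - 1)) := by
  have := hM.integral_comp (f := fun n : ℕ => s ^ n) (by fun_prop)
  simp only [Function.comp_def] at this
  rw [this, integral_poissonMeasure]
  have h2 : HasSum (fun n : ℕ => (α * s : ℝ) ^ n / n.factorial) (Real.exp (α * s)) := by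
    rw [Real.exp_eq_exp_ℝ]; exact NormedSpace.expSeries_div_hasSum_exp (α * s : ℝ)
  have h3 := h2.mul_left (Real.exp (-(α : ℝ)))
  rw [← Real.exp_add] at h3
  convert h3.tsum_eq using 1
  · congr 1; funext n; simp only [smul_eq_mul]; ring
  · congr 1; ring

variable [IsProbabilityMeasure μ]

/-- The expectation of a product over the children, for a binary tree with offspring generating
function `((1 + h) / 2) ^ 2`. -/
lemma integral_mul_prod_children (hN : ∀ v, Measurable (N v)) (hA : ∀ v, Measurable (A v))
    (hNlaw : ∀ v, HasLaw (N v) offspringLaw μ)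
    (hindep : iIndepFun (Sum.elim N A) μ) (v : Vertex) (f : ℕ → ℝ)
    {Z : Fin 2 → Ω → ℝ}
    (hZ : ∀ i, Measurable[marksSigma N A (descendantMarks (i :: v))] (Z i))
    (hb : ∀ i ω, |Z i ω| ≤ 1) {h : ℝ} (hh : ∀ i, ∫ ω, Z i ω ∂μ = h) :
    ∫ ω, f (A v ω) * ∏ i : Fin 2, (if (i : ℕ) < N v ω then Z i ω else 1) ∂μ =
      (∫ ω, f (A v ω) ∂μ) * ((1 + h) / 2) ^ 2 := by
  obtain ⟨h1, h2, h3⟩ := indepFun_subtrees hN hA hindep v hZ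
  have hZm : ∀ i, Measurable (Z i) := fun i => (hZ i).mono (marksSigma_le hN hA _) le_rfl
  have hW : Measurable (fun p : ℕ × ℝ × ℝ =>
      (if 0 < p.1 then p.2.1 else 1) * if 1 < p.1 then p.2.2 else 1) := by
    refine measurable_from_prod_countable_right fun n => ?_
    by_cases h0 : 0 < n <;> by_cases h1 : 1 < n <;> simp only [h0, h1, if_true, if_false] <;>
      fun_prop
  have e1 : ∫ ω, f (A v ω) * ∏ i : Fin 2, (if (i : ℕ) < N v ω then Z i ω else 1) ∂μ =
      (∫ ω, f (A v ω) ∂μ) *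
        ∫ ω, (if 0 < N v ω then Z 0 ω else 1) * (if 1 < N v ω then Z 1 ω else 1) ∂μ := by
    have hi := h1.comp (φ := f) (by fun_prop) hW
    have := hi.integral_fun_mul_eq_mul_integral (by fun_prop)
      ((hW.comp ((hN v).prodMk ((hZm 0).prodMk (hZm 1)))).aestronglyMeasurable)
    simpa [Function.comp_def, Fin.prod_univ_two] using this
  rw [e1]
  congr 1
  -- almost surely there are at most two children; the product is split by their number
  have e2 : (fun ω => (if 0 < N v ω then Z 0 ω else 1) * (if 1 < N v ω then Z 1 ω else 1))
      =ᵐ[μ] fun ω => (Pi.single 0 1 : ℕ → ℝ) (N v ω) + (Pi.single 1 1 : ℕ → ℝ) (N v ω) * Z 0 ω +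
        (Pi.single 2 1 : ℕ → ℝ) (N v ω) * (Z 0 ω * Z 1 ω) := by
    filter_upwards [ae_le_of_hasLaw_binomial (hNlaw v)] with ω hω
    interval_cases N v ω <;> simp
  have bsing : ∀ k n : ℕ, ‖(Pi.single k 1 : ℕ → ℝ) n‖ ≤ 1 := by
    intro k n; by_cases hkn : n = k <;> simp [hkn]
  have hS : ∀ k, Measurable fun ω => (Pi.single k 1 : ℕ → ℝ) (N v ω) :=
    fun k => Measurable.of_discrete.comp (hN v)
  have i0 : Integrable (fun ω => (Pi.single 0 1 : ℕ → ℝ) (N v ω)) μ :=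
    Integrable.of_bound (hS 0).aestronglyMeasurable 1 (ae_of_all _ fun ω => bsing _ _)
  have i1 : Integrable (fun ω => (Pi.single 1 1 : ℕ → ℝ) (N v ω) * Z 0 ω) μ := by
    refine Integrable.of_bound ((hS 1).mul (hZm 0)).aestronglyMeasurable 1
      (ae_of_all _ fun ω => ?_)
    rw [norm_mul]
    exact mul_le_one₀ (bsing _ _) (norm_nonneg _) (hb 0 ω)
  have i2 : Integrable (fun ω => (Pi.single 2 1 : ℕ → ℝ) (N v ω) * (Z 0 ω * Z 1 ω)) μ := by
    refine Integrable.of_bound ((hS 2).mul ((hZm 0).mul (hZm 1))).aestronglyMeasurable 1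
      (ae_of_all _ fun ω => ?_)
    rw [norm_mul, norm_mul]
    exact mul_le_one₀ (bsing _ _) (by positivity)
      (mul_le_one₀ (hb 0 ω) (norm_nonneg _) (hb 1 ω))
  have m1 : ∫ ω, (Pi.single 1 1 : ℕ → ℝ) (N v ω) * Z 0 ω ∂μ = 1 / 2 * h := by
    have := (h2.comp (φ := (Pi.single 1 1 : ℕ → ℝ)) (by fun_prop)
      measurable_fst).integral_fun_mul_eq_mul_integral (hS 1).aestronglyMeasurable
        (hZm 0).aestronglyMeasurable
    simp only [Function.comp_def] at this
    rw [this, hh, integral_single_offspring (hNlaw v)]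
    norm_num
  have m2 : ∫ ω, (Pi.single 2 1 : ℕ → ℝ) (N v ω) * (Z 0 ω * Z 1 ω) ∂μ = 1 / 4 * (h * h) := by
    have := (h2.comp (φ := (Pi.single 2 1 : ℕ → ℝ)) (by fun_prop)
      (measurable_fst.mul measurable_snd)).integral_fun_mul_eq_mul_integral
        (hS 2).aestronglyMeasurable ((hZm 0).mul (hZm 1)).aestronglyMeasurable
    simp only [Function.comp_def, Pi.mul_apply] at this
    rw [this, integral_single_offspring (hNlaw v), h3.integral_fun_mul_eq_mul_integral
      (hZm 0).aestronglyMeasurable (hZm 1).aestronglyMeasurable, hh, hh]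
    norm_num
  rw [integral_congr_ae e2, integral_add (f := fun ω => (Pi.single 0 1 : ℕ → ℝ) (N v ω) +
    (Pi.single 1 1 : ℕ → ℝ) (N v ω) * Z 0 ω) (i0.add i1) i2, integral_add i0 i1, m1, m2,
    integral_single_offspring (hNlaw v)]
  norm_num
  ring

/-- The probability that the critical tree survives for `n` generations is at most `4 / (n + 4)`,
because the extinction probabilities satisfy `q' = ((1 + q) / 2) ^ 2`. -/
lemma exists_integral_diesOut (hN : ∀ v, Measurable (N v)) (hA : ∀ v, Measurable (A v))
    (hNlaw : ∀ v, HasLaw (N v) offspringLaw μ)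
    (hindep : iIndepFun (Sum.elim N A) μ) (n : ℕ) :
    ∃ q : ℝ, (∀ v, ∫ ω, (diesOut (fun u => N u ω) n v : ℝ) ∂μ = q) ∧ 0 ≤ q ∧ q ≤ 1 ∧
      1 - q ≤ 4 / (n + 4) := by
  induction n with
  | zero => exact ⟨0, by simp [diesOut], by norm_num, by norm_num, by norm_num⟩
  | succ n ih =>
    obtain ⟨q, hq, hq0, hq1, hq4⟩ := ih
    refine ⟨((1 + q) / 2) ^ 2, fun v => ?_, by positivity, ?_, ?_⟩
    · have := integral_mul_prod_children hN hA hNlaw hindep v (fun _ => 1)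
        (Z := fun i ω => (diesOut (fun u => N u ω) n (i :: v) : ℝ))
        (fun i => Measurable.of_discrete.comp (measurable_diesOut n (i :: v)))
        (fun i ω => by
          rw [abs_of_nonneg (by positivity)]
          exact_mod_cast diesOut_le_one _ n (i :: v)) (fun i => hq _)
      simpa [diesOut] using this
    · nlinarith
    · have h5 : (0 : ℝ) < n + 4 := by positivity
      have h6 : (0 : ℝ) < n + 1 + 4 := by positivity
      -- `e ↦ e - e² / 4` is increasing on `[0, 2]`
      have h7 : 1 - ((1 + q) / 2) ^ 2 ≤ 4 / (n + 4) - (4 / (n + 4)) ^ 2 / 4 := by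
        have h8 : (4 : ℝ) / (n + 4) ≤ 1 := by
          rw [div_le_one h5]; linarith [(Nat.cast_nonneg n : (0 : ℝ) ≤ n)]
        nlinarith
      refine h7.trans ?_
      push_cast
      rw [div_pow, div_div, div_sub_div _ _ h5.ne' (by positivity),
        div_le_div_iff₀ (by positivity) h6]
      nlinarith [sq_nonneg ((n : ℝ) + 4), mul_pos h5 h5]

/-- The critical tree dies out almost surely. -/
lemma ae_exists_diesOut (hN : ∀ v, Measurable (N v)) (hA : ∀ v, Measurable (A v))
    (hNlaw : ∀ v, HasLaw (N v) offspringLaw μ)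
    (hindep : iIndepFun (Sum.elim N A) μ) :
    ∀ᵐ ω ∂μ, ∃ n, diesOut (fun u => N u ω) n [] ≠ 0 := by
  have hm : ∀ n, Measurable fun ω => diesOut (fun u => N u ω) n [] := fun n =>
    (measurable_diesOut (A := A) n []).mono (marksSigma_le hN hA _) le_rfl
  rw [ae_iff]
  simp only [not_exists, not_not]
  have key : ∀ n : ℕ, μ.real {ω | ∀ n, diesOut (fun u => N u ω) n [] = 0} ≤ 4 / (n + 4) := by
    intro n
    obtain ⟨q, hq, -, -, hq4⟩ := exists_integral_diesOut hN hA hNlaw hindep n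
    have hms : MeasurableSet {ω | diesOut (fun u => N u ω) n [] = 0} :=
      hm n (measurableSet_singleton 0)
    have hmc : Measurable fun ω => (diesOut (fun u => N u ω) n [] : ℝ) :=
      Measurable.of_discrete.comp (hm n)
    have hi : Integrable (fun ω => (diesOut (fun u => N u ω) n [] : ℝ)) μ :=
      Integrable.of_bound hmc.aestronglyMeasurable 1 (ae_of_all _ fun ω => by
        rw [Real.norm_of_nonneg (by positivity)]
        exact_mod_cast diesOut_le_one _ n [])
    calc μ.real {ω | ∀ n, diesOut (fun u => N u ω) n [] = 0}
        ≤ μ.real {ω | diesOut (fun u => N u ω) n [] = 0} := measureReal_mono fun ω h => h n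
      _ = ∫ ω, {ω | diesOut (fun u => N u ω) n [] = 0}.indicator 1 ω ∂μ :=
          (integral_indicator_one hms).symm
      _ ≤ ∫ ω, (1 - (diesOut (fun u => N u ω) n [] : ℝ)) ∂μ := by
          refine integral_mono ((integrable_const 1).indicator hms)
            ((integrable_const 1).sub hi) fun ω => ?_
          by_cases h : diesOut (fun u => N u ω) n [] = 0
          · simp [h]
          · have : (diesOut (fun u => N u ω) n [] : ℝ) ≤ 1 := by
              exact_mod_cast diesOut_le_one _ n []
            simpa [h] using this
      _ = 1 - q := by rw [integral_sub (integrable_const 1) hi, hq]; simp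
      _ ≤ 4 / (n + 4) := hq4
  have h0 : μ.real {ω | ∀ n, diesOut (fun u => N u ω) n [] = 0} ≤ 0 := by
    refine ge_of_tendsto' (x := atTop) ?_ key
    exact tendsto_const_nhds.div_atTop (tendsto_natCast_atTop_atTop.atTop_add tendsto_const_nhds)
  exact (measureReal_eq_zero_iff).1 (le_antisymm h0 measureReal_nonneg)

lemma pow_visits_succ (c a : Vertex → ℕ) (n : ℕ) (v : Vertex) (s : ℝ) :
    s ^ visits c a (n + 1) v =
      s ^ a v * ∏ i : Fin 2, if (i : ℕ) < c v then s ^ (visits c a n (i :: v) - 1) else 1 := by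
  rw [visits, pow_add, ← Finset.prod_pow_eq_pow_sum]
  congr 1
  refine Finset.prod_congr rfl fun i _ => ?_
  split_ifs <;> simp

lemma abs_pow_le_one {s : ℝ} (hs : s ∈ Set.Icc (0 : ℝ) 1) (n : ℕ) : |s ^ n| ≤ 1 := by
  rw [abs_of_nonneg (pow_nonneg hs.1 n)]
  exact pow_le_one₀ hs.1 hs.2

/-- The recursive equation for trees cut at finite height. -/
lemma integral_pow_visits_succ {α : NNReal} (hN : ∀ v, Measurable (N v))
    (hA : ∀ v, Measurable (A v)) (hNlaw : ∀ v, HasLaw (N v) offspringLaw μ)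
    (hAlaw : ∀ v, HasLaw (A v) (poissonMeasure α) μ)
    (hindep : iIndepFun (Sum.elim N A) μ) (n : ℕ) {s : ℝ} (hs : s ∈ Set.Icc (0 : ℝ) 1) :
    ∫ ω, s ^ visits (fun u => N u ω) (fun u => A u ω) (n + 1) [] ∂μ =
      Real.exp (α * (s - 1)) *
        ((1 + ∫ ω, s ^ (visits (fun u => N u ω) (fun u => A u ω) n [] - 1) ∂μ) / 2) ^ 2 := by
  obtain ⟨ν, hν⟩ := exists_hasLaw_visits hN hA hNlaw hAlaw hindep n
  have hsame : ∀ v, ∫ ω, s ^ (visits (fun u => N u ω) (fun u => A u ω) n v - 1) ∂μ =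
      ∫ k, s ^ (k - 1) ∂ν := fun v =>
    (hν v).integral_comp (f := fun k : ℕ => s ^ (k - 1)) (by fun_prop)
  have := integral_mul_prod_children hN hA hNlaw hindep [] (fun k => s ^ k)
    (Z := fun i ω => s ^ (visits (fun u => N u ω) (fun u => A u ω) n [i] - 1))
    (fun i => (Measurable.of_discrete (f := fun k : ℕ => s ^ (k - 1))).comp
      (measurable_visits n [i]))
    (fun i ω => abs_pow_le_one hs _) (fun i => hsame [i])
  simp only [pow_visits_succ]
  rw [this, integral_pow_poisson (hAlaw []), hsame]

/-- The recursive equation when the marks are measurable functions. -/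
lemma integral_pow_eq_of_measurable {α : NNReal} (hN : ∀ v, Measurable (N v))
    (hA : ∀ v, Measurable (A v)) (hNlaw : ∀ v, HasLaw (N v) offspringLaw μ)
    (hAlaw : ∀ v, HasLaw (A v) (poissonMeasure α) μ)
    (hindep : iIndepFun (Sum.elim N A) μ) {X : Ω → ℕ}
    (hX : ∀ᵐ ω ∂μ, ∀ n, diesOut (fun u => N u ω) n [] ≠ 0 →
      ∀ m, n ≤ m → X ω = visits (fun u => N u ω) (fun u => A u ω) m []) :
    AEMeasurable X μ ∧ ∀ s ∈ Set.Icc (0 : ℝ) 1, ∫ ω, s ^ X ω ∂μ =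
      Real.exp (α * (s - 1)) * ((1 + ∫ ω, s ^ (X ω - 1) ∂μ) / 2) ^ 2 := by
  have hm : ∀ n, Measurable fun ω => visits (fun u => N u ω) (fun u => A u ω) n [] := fun n =>
    (measurable_visits n []).mono (marksSigma_le hN hA _) le_rfl
  have hev : ∀ᵐ ω ∂μ, ∀ᶠ m in atTop,
      X ω = visits (fun u => N u ω) (fun u => A u ω) m [] := by
    filter_upwards [ae_exists_diesOut hN hA hNlaw hindep, hX] with ω ⟨n, hn⟩ h
    exact eventually_atTop.2 ⟨n, h n hn⟩
  have hlim : ∀ f : ℕ → ℝ, ∀ᵐ ω ∂μ,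
      Tendsto (fun m => f (visits (fun u => N u ω) (fun u => A u ω) m [])) atTop
        (𝓝 (f (X ω))) := by
    intro f
    filter_upwards [hev] with ω h
    exact tendsto_const_nhds.congr' (h.mono fun m hm => by rw [hm])
  have hXm : AEMeasurable X μ := by
    refine aemeasurable_of_tendsto_metrizable_ae atTop (fun n => (hm n).aemeasurable) ?_
    filter_upwards [hev] with ω h
    exact tendsto_const_nhds.congr' h
  refine ⟨hXm, fun s hs => ?_⟩
  have hint : ∀ f : ℕ → ℝ, (∀ k, |f k| ≤ 1) →
      Tendsto (fun m => ∫ ω, f (visits (fun u => N u ω) (fun u => A u ω) m []) ∂μ) atTop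
        (𝓝 (∫ ω, f (X ω) ∂μ)) := fun f hf =>
    tendsto_integral_of_dominated_convergence (fun _ => 1)
      (fun n => (Measurable.of_discrete.comp (hm n)).aestronglyMeasurable)
      (integrable_const 1) (fun n => ae_of_all _ fun ω => hf _) (hlim f)
  have h1 := (hint (fun k => s ^ k) fun k => abs_pow_le_one hs k).comp (tendsto_add_atTop_nat 1)
  have h2 := hint (fun k => s ^ (k - 1)) fun k => abs_pow_le_one hs _
  refine tendsto_nhds_unique h1 ?_
  refine (((h2.const_add 1).div_const 2).pow 2 |>.const_mul (Real.exp (α * (s - 1)))).congr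
    fun m => ?_
  exact (integral_pow_visits_succ hN hA hNlaw hAlaw hindep m hs).symm

/-- The generating function of the number `X` of cars visiting the root satisfies
`E[s ^ X] = e^{α (s - 1)} ((1 + E[s ^ (X - 1)⁺]) / 2) ^ 2`: the root is visited by its own cars and,
for each child, by all but the first of the cars visiting that child. -/
theorem integral_pow_eq {α : NNReal} (hNlaw : ∀ v, HasLaw (N v) offspringLaw μ)
    (hAlaw : ∀ v, HasLaw (A v) (poissonMeasure α) μ)
    (hindep : iIndepFun (Sum.elim N A) μ)
    {L : Ω → List Vertex}
    (hL : ∀ ω, (familyTree (fun v => N v ω)).Finite →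
      IsArrivalSequence (familyTree (fun v => N v ω)) (fun v => A v ω) (L ω))
    {X : Ω → ℕ} (hX : ∀ ω, X ω = rootVisits (L ω)) :
    AEMeasurable X μ ∧ ∀ s ∈ Set.Icc (0 : ℝ) 1, ∫ ω, s ^ X ω ∂μ =
      Real.exp (α * (s - 1)) * ((1 + ∫ ω, s ^ (X ω - 1) ∂μ) / 2) ^ 2 := by
  -- the marks are only almost everywhere measurable, so they are replaced by measurable versions
  let N' : Vertex → Ω → ℕ := fun v => (hNlaw v).aemeasurable.mk (N v)
  let A' : Vertex → Ω → ℕ := fun v => (hAlaw v).aemeasurable.mk (A v)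
  have eN : ∀ v, N v =ᵐ[μ] N' v := fun v => (hNlaw v).aemeasurable.ae_eq_mk
  have eA : ∀ v, A v =ᵐ[μ] A' v := fun v => (hAlaw v).aemeasurable.ae_eq_mk
  refine integral_pow_eq_of_measurable (N := N') (A := A')
    (fun v => (hNlaw v).aemeasurable.measurable_mk)
    (fun v => (hAlaw v).aemeasurable.measurable_mk)
    (fun v => (hNlaw v).congr (eN v).symm) (fun v => (hAlaw v).congr (eA v).symm)
    (hindep.congr fun x => ?_) ?_
  · cases x with
    | inl v => exact eN v
    | inr v => exact eA v
  · filter_upwards [ae_all_iff.2 eN, ae_all_iff.2 eA] with ω h1 h2 n hn m hnm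
    rw [hX ω]
    simp only [← h1, ← h2] at hn ⊢
    exact rootVisits_eq_visits_of_diesOut hn (hL ω) hnm

end Recursion

/-! ### The radicand and its zeros -/

section Radicand

variable {α p s : ℝ}

/-- The derivative of the radicand. -/
noncomputable def radicandDeriv (α p s : ℝ) : ℝ :=
  2 * s - Real.exp (α * (s - 1)) * (α * (s * (1 + p) - p) + (1 + p))

/-- The quadratic polynomial satisfied by the double zeros of the radicand; `switchPoint α p` is
its smaller root. -/
def switchPoly (α p s : ℝ) : ℝ :=
  α * (1 + p) * s ^ 2 - (1 + p + α * p) * s + 2 * p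

lemma hasDerivAt_expFactor (α s : ℝ) :
    HasDerivAt (fun s => Real.exp (α * (s - 1))) (Real.exp (α * (s - 1)) * α) s := by
  have : HasDerivAt (fun s => α * (s - 1)) α s := by
    simpa using ((hasDerivAt_id s).sub_const 1).const_mul α
  exact this.exp

lemma hasDerivAt_radicand (α p s : ℝ) :
    HasDerivAt (radicand α p) (radicandDeriv α p s) s := by
  have h1 : HasDerivAt (fun s : ℝ => s * (1 + p) - p) (1 + p) s := by
    simpa using ((hasDerivAt_id s).mul_const (1 + p)).sub_const p
  have h2 := (hasDerivAt_pow 2 s).sub ((hasDerivAt_expFactor α s).mul h1)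
  refine h2.congr_deriv ?_
  simp only [radicandDeriv]
  push_cast
  ring

lemma radicand_one (α p : ℝ) : radicand α p 1 = 0 := by
  simp [radicand]

lemma radicandDeriv_one (α p : ℝ) : radicandDeriv α p 1 = 1 - α - p := by
  simp [radicandDeriv]; ring

lemma continuous_radicand (α p : ℝ) : Continuous (radicand α p) :=
  continuous_iff_continuousAt.2 fun s => (hasDerivAt_radicand α p s).continuousAt

lemma tendsto_radicand_div (α p : ℝ) :
    Tendsto (fun s => radicand α p s / (1 - s)) (𝓝[<] 1) (𝓝 (p - (1 - α))) := by
  have h := (hasDerivWithinAt_iff_tendsto_slope' (s := Set.Iio (1 : ℝ)) (by simp)).1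
    (hasDerivAt_radicand α p 1).hasDerivWithinAt
  rw [radicandDeriv_one] at h
  have h2 := h.neg
  rw [show -(1 - α - p) = p - (1 - α) by ring] at h2
  refine h2.congr fun s => ?_
  rw [slope_def_field, radicand_one, sub_zero, ← div_neg, neg_sub]

/-- The second-order expansion of the radicand at `1` for `p = 1 - α`. -/
lemma tendsto_radicand_div_sq (α : ℝ) :
    Tendsto (fun s => radicand α (1 - α) s / (1 - s) ^ 2) (𝓝[<] 1)
      (𝓝 ((α ^ 2 - 4 * α + 2) / 2)) := by
  have h2 : HasDerivAt (radicandDeriv α (1 - α)) (α ^ 2 - 4 * α + 2) 1 := by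
    have h1 : HasDerivAt (fun s : ℝ => α * (s * (1 + (1 - α)) - (1 - α)) + (1 + (1 - α)))
        (α * (1 + (1 - α))) 1 := by
      simpa using ((((hasDerivAt_id (1 : ℝ)).mul_const (1 + (1 - α))).sub_const
        (1 - α)).const_mul α).add_const (1 + (1 - α))
    have h3 := ((hasDerivAt_id (1 : ℝ)).const_mul 2).sub ((hasDerivAt_expFactor α 1).mul h1)
    refine h3.congr_deriv ?_
    simp
    ring
  have hs := (hasDerivWithinAt_iff_tendsto_slope' (s := Set.Iio (1 : ℝ)) (by simp)).1
    h2.hasDerivWithinAt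
  have hd : ∀ s : ℝ, HasDerivAt (fun s : ℝ => (1 - s) ^ 2) (-2 * (1 - s)) s := by
    intro s
    have := ((hasDerivAt_id s).const_sub 1).pow 2
    refine this.congr_deriv ?_
    simp
  refine HasDerivAt.lhopital_zero_nhdsLT (f' := radicandDeriv α (1 - α))
    (g' := fun s => -2 * (1 - s)) (Eventually.of_forall fun s => hasDerivAt_radicand _ _ s)
    (Eventually.of_forall hd) ?_ ?_ ?_ ?_
  · filter_upwards [self_mem_nhdsWithin] with s hs
    have : (s : ℝ) < 1 := hs
    simp only [ne_eq, mul_eq_zero, not_or]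
    exact ⟨by norm_num, by linarith⟩
  · have := (continuous_radicand α (1 - α)).tendsto 1
    rw [radicand_one] at this
    exact this.mono_left nhdsWithin_le_nhds
  · have : Continuous fun s : ℝ => (1 - s) ^ 2 := by fun_prop
    have := this.tendsto 1
    norm_num at this
    exact this.mono_left nhdsWithin_le_nhds
  · refine (hs.div_const 2).congr' ?_
    filter_upwards [self_mem_nhdsWithin] with s hs
    have : (s : ℝ) < 1 := hs
    rw [slope_def_field, radicandDeriv_one, div_div]
    congr 1 <;> ring

/-- A non-negative radicand forces `p ≥ 1 - α`. -/
lemma one_sub_le_of_radicand_nonneg (h : ∀ s ∈ Set.Icc (0 : ℝ) 1, 0 ≤ radicand α p s) :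
    1 - α ≤ p := by
  have : 0 ≤ p - (1 - α) := by
    refine ge_of_tendsto (tendsto_radicand_div α p) ?_
    filter_upwards [Ioo_mem_nhdsLT (show (0 : ℝ) < 1 by norm_num)] with s hs
    exact div_nonneg (h s ⟨hs.1.le, hs.2.le⟩) (by linarith [hs.2])
  linarith

/-- A radicand of second order at `1` forces `p ≤ 1 - α`. -/
lemma le_one_sub_of_radicand_le {C : ℝ}
    (h : ∃ᶠ s in 𝓝[<] (1 : ℝ), radicand α p s ≤ C * (1 - s) ^ 2) : p ≤ 1 - α := by
  by_contra! hlt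
  have h1 : Tendsto (fun s : ℝ => C * (1 - s)) (𝓝[<] 1) (𝓝 0) := by
    have : Continuous fun s : ℝ => C * (1 - s) := by fun_prop
    have := this.tendsto 1
    norm_num at this
    exact this.mono_left nhdsWithin_le_nhds
  have h2 := (tendsto_radicand_div α p).sub h1
  have h3 : ∀ᶠ s in 𝓝[<] (1 : ℝ), 0 < radicand α p s / (1 - s) - C * (1 - s) :=
    h2.eventually (lt_mem_nhds (by linarith))
  refine h ?_
  filter_upwards [h3, self_mem_nhdsWithin] with s hs hs1
  have hs2 : 0 < 1 - s := sub_pos.2 hs1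
  rw [sub_pos, lt_div_iff₀ hs2] at hs
  nlinarith

lemma two_sub_sqrt_two_lt (h : α ^ 2 - 4 * α + 2 < 0) : 2 - √2 < α := by
  have h1 : |α - 2| < √2 := by
    rw [Real.lt_sqrt (abs_nonneg _), sq_abs]
    linarith
  linarith [(abs_lt.1 h1).1]

/-- At an interior zero, a non-negative radicand has a double zero. -/
lemma switchPoly_eq_zero (h : ∀ s ∈ Set.Icc (0 : ℝ) 1, 0 ≤ radicand α p s)
    (hs : s ∈ Set.Ioo (0 : ℝ) 1) (h0 : radicand α p s = 0) :
    switchPoly α p s = 0 ∧ 0 < s * (1 + p) - p := by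
  have hmin : IsLocalMin (radicand α p) s := by
    filter_upwards [Ioo_mem_nhds hs.1 hs.2] with x hx
    rw [h0]
    exact h x ⟨hx.1.le, hx.2.le⟩
  have hd := hmin.hasDerivAt_eq_zero (hasDerivAt_radicand α p s)
  have hE := Real.exp_pos (α * (s - 1))
  simp only [radicand, radicandDeriv] at h0 hd
  set E := Real.exp (α * (s - 1))
  set u := s * (1 + p) - p with hu
  have hu0 : 0 < u := by
    have : 0 < E * u := by have := pow_pos hs.1 2; linarith
    exact pos_of_mul_pos_right this hE.le
  refine ⟨?_, hu0⟩
  -- eliminate the exponential from the two equations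
  have h1 : s * E * (2 * u - s * (α * u + (1 + p))) = 0 := by
    linear_combination (-2 * s) * h0 + s ^ 2 * hd
  have h2 : 2 * u - s * (α * u + (1 + p)) = 0 := by
    have : s * E ≠ 0 := (mul_pos hs.1 hE).ne'
    exact (mul_eq_zero.1 h1).resolve_left this
  simp only [switchPoly]
  rw [hu] at h2
  linear_combination -h2

/-- Beyond a point from which on `switchPoly` is positive, the radicand has no zeros before `1`. -/
lemma radicand_pos_of_switchPoly_pos (hp : 0 < p) (hs : s ∈ Set.Ioo (0 : ℝ) 1)
    (hu : 0 < s * (1 + p) - p) (hq : ∀ x ∈ Set.Ioo s 1, 0 < switchPoly α p x) :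
    0 < radicand α p s := by
  have hux : ∀ x, s ≤ x → 0 < x * (1 + p) - p := fun x hx => by nlinarith
  have hd : ∀ x, s ≤ x → HasDerivAt
      (fun x => 2 * Real.log x - α * (x - 1) - Real.log (x * (1 + p) - p))
      (-switchPoly α p x / (x * (x * (1 + p) - p))) x := by
    intro x hx
    have hx0 : 0 < x := hs.1.trans_le hx
    have hu1 := hux x hx
    have h1 : HasDerivAt (fun s : ℝ => s * (1 + p) - p) (1 + p) x := by
      simpa using ((hasDerivAt_id x).mul_const (1 + p)).sub_const p
    have h2 := (((Real.hasDerivAt_log hx0.ne').const_mul 2).sub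
      (((hasDerivAt_id x).sub_const 1).const_mul α)).sub (h1.log hu1.ne')
    refine h2.congr_deriv ?_
    simp only [switchPoly]
    field_simp
    ring
  have hanti : StrictAntiOn
      (fun x => 2 * Real.log x - α * (x - 1) - Real.log (x * (1 + p) - p)) (Set.Icc s 1) := by
    refine strictAntiOn_of_deriv_neg (convex_Icc s 1)
      (fun x hx => (hd x hx.1).continuousAt.continuousWithinAt) fun x hx => ?_
    rw [interior_Icc] at hx
    rw [(hd x hx.1.le).deriv]
    exact div_neg_of_neg_of_pos (neg_lt_zero.2 (hq x hx))
      (mul_pos (hs.1.trans hx.1) (hux x hx.1.le))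
  have h1 := hanti (Set.left_mem_Icc.2 hs.2.le) (Set.right_mem_Icc.2 hs.2.le) hs.2
  simp only [one_mul, add_sub_cancel_right, Real.log_one, sub_self, mul_zero] at h1
  have h2 : Real.exp (α * (s - 1)) * (s * (1 + p) - p) < s ^ 2 := by
    rw [← Real.exp_log hu, ← Real.exp_add, ← Real.exp_log (pow_pos hs.1 2), Real.exp_lt_exp,
      Real.log_pow]
    push_cast
    linarith
  exact sub_pos.2 h2

/-- For `p > 1 - α` an interior zero of a non-negative radicand is strictly smaller than the other
root of `switchPoly`, which in turn is smaller than `1`. -/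
lemma interior_zero_bounds (hp : 0 < p) (hα : 0 < α) (hpα : 1 - α < p)
    (h : ∀ s ∈ Set.Icc (0 : ℝ) 1, 0 ≤ radicand α p s)
    (hs : s ∈ Set.Ioo (0 : ℝ) 1) (h0 : radicand α p s = 0) :
    2 * (α * (1 + p)) * s < 1 + p + α * p ∧ 1 + p + α * p < α * (1 + p) * (1 + s) := by
  obtain ⟨hq, hu⟩ := switchPoly_eq_zero h hs h0
  have hA : 0 < α * (1 + p) := by positivity
  simp only [switchPoly] at hq
  constructor
  · by_contra! hle
    have := radicand_pos_of_switchPoly_pos hp hs hu (α := α) fun x hx => by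
      have h1 : 0 < (x - s) * (α * (1 + p) * (x + s) - (1 + p + α * p)) := by
        refine mul_pos (sub_pos.2 hx.1) ?_
        nlinarith [mul_lt_mul_of_pos_left hx.1 hA]
      simp only [switchPoly]
      linarith
    linarith
  -- `switchPoly` vanishes at `s` and is `α + p - 1 > 0` at `1`
  · have h1 : 0 < (1 - s) * (α * (1 + p) * (1 + s) - (1 + p + α * p)) := by
      linarith
    linarith [pos_of_mul_pos_right h1 (by linarith [hs.2])]

/-- For `p > 1 - α` the only possible interior zero of a non-negative radicand is the switch
point. -/
lemma eq_switchPoint (hp : 0 < p) (hα : 0 < α) (hpα : 1 - α < p)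
    (h : ∀ s ∈ Set.Icc (0 : ℝ) 1, 0 ≤ radicand α p s)
    (hs : s ∈ Set.Ioo (0 : ℝ) 1) (h0 : radicand α p s = 0) :
    s = switchPoint α p ∧ 0 < switchDiscrim α p := by
  obtain ⟨hq, -⟩ := switchPoly_eq_zero h hs h0
  obtain ⟨h1, -⟩ := interior_zero_bounds hp hα hpα h hs h0
  have hd : switchDiscrim α p = (1 + p + α * p - 2 * (α * (1 + p)) * s) ^ 2 := by
    simp only [switchPoly] at hq
    simp only [switchDiscrim]
    linear_combination (-4 * (α * (1 + p))) * hq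
  constructor
  · rw [switchPoint, hd, Real.sqrt_sq (by linarith), eq_div_iff (by positivity)]
    ring
  · rw [hd]
    exact pow_pos (by linarith) 2

/-- For `p > 1 - α` an interior zero of a non-negative radicand forces `α > 2 - √2` and
`p < upperBound α`. -/
lemma lt_upperBound (hp : 0 < p) (hα : 0 < α) (hpα : 1 - α < p)
    (h : ∀ s ∈ Set.Icc (0 : ℝ) 1, 0 ≤ radicand α p s)
    (hs : s ∈ Set.Ioo (0 : ℝ) 1) (h0 : radicand α p s = 0) :
    2 - √2 < α ∧ p < upperBound α := by
  obtain ⟨-, hu⟩ := switchPoly_eq_zero h hs h0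
  obtain ⟨h1, h2⟩ := interior_zero_bounds hp hα hpα h hs h0
  obtain ⟨-, hD⟩ := eq_switchPoint hp hα hpα h hs h0
  have hA : 0 < α * (1 + p) := by positivity
  have hr : (√2 : ℝ) ^ 2 = 2 := Real.sq_sqrt (by norm_num)
  have hr1 : (1.4 : ℝ) < √2 := Real.lt_sqrt_of_sq_lt (by norm_num)
  have hr2 : (√2 : ℝ) < 1.42 := (Real.sqrt_lt' (by norm_num)).2 (by norm_num)
  have h3 : 1 + p + α * p < 2 * (α * (1 + p)) := by nlinarith [hs.2]
  have hα2 : 2 - √2 < α := by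
    rcases lt_or_ge α 1 with hα1 | hα1
    · refine two_sub_sqrt_two_lt ?_
      nlinarith
    · linarith
  refine ⟨hα2, ?_⟩
  -- this holds since the zero lies to the right of `p / (1 + p)` and to the left of the vertex of
  -- the parabola `switchPoly`
  have h4 : α * p < 1 + p := by
    have h5 : 2 * (α * (1 + p)) * (s * (1 + p)) < (1 + p + α * p) * (1 + p) := by nlinarith
    have h6 : 2 * (α * (1 + p)) * p < (1 + p + α * p) * (1 + p) := by nlinarith
    have h7 : 2 * α * p < 1 + p + α * p := by
      have : 0 < (1 + p) * (1 + p + α * p - 2 * α * p) := by linarith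
      linarith [pos_of_mul_pos_right this (by linarith)]
    linarith
  have hfac : switchDiscrim α p = (p * (α - (3 - 2 * √2)) - (3 - 2 * √2)) *
      (p * (α - (3 + 2 * √2)) - (3 + 2 * √2)) := by
    simp only [switchDiscrim]
    linear_combination (4 * p ^ 2 + 8 * p + 4) * hr
  -- so one factor of the positive discriminant is negative, and hence the other one too
  have h8 : p * (α - (3 + 2 * √2)) - (3 + 2 * √2) < 0 := by nlinarith
  have h9 : p * (α - (3 - 2 * √2)) < 3 - 2 * √2 := by
    rw [hfac] at hD
    linarith [neg_of_mul_pos_left hD h8.le]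
  have h10 : 0 < α - (3 - 2 * √2) := by linarith
  have h11 : upperBound α = (3 - 2 * √2) / (α - (3 - 2 * √2)) := by
    rw [upperBound]
    split_ifs with hα3
    · rw [eq_div_iff h10.ne', hα3]
      linear_combination (3 / 2 : ℝ) * hr
    · have h12 : α ^ 2 - 6 * α + 1 = (α - (3 + 2 * √2)) * (α - (3 - 2 * √2)) := by
        linear_combination 4 * hr
      have h13 : α - (3 + 2 * √2) ≠ 0 := sub_ne_zero.2 hα3
      rw [h12, div_eq_div_iff (mul_ne_zero h13 h10.ne') h10.ne']
      linear_combination (-4 * (α - (3 - 2 * √2))) * hr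
  rw [h11, lt_div_iff₀ h10]
  exact h9

end Radicand

/-! ### Solving the recursive equation -/

/-- The properties of `G s = E[s ^ X]` and `H s = E[s ^ (X - 1)⁺]`, with `p = P(X = 0)`, that
determine `G` and `p`. -/
structure IsVisitPGF (α p : ℝ) (G H : ℝ → ℝ) : Prop where
  nonneg : 0 ≤ α
  le_one : p ≤ 1
  continuousOn : ContinuousOn H (Set.Icc 0 1)
  pgf_nonneg : ∀ s ∈ Set.Icc (0 : ℝ) 1, 0 ≤ G s
  pgf_le : ∀ s ∈ Set.Icc (0 : ℝ) 1, G s ≤ H s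
  shift_le_one : ∀ s ∈ Set.Icc (0 : ℝ) 1, H s ≤ 1
  shift_eq : ∀ s ∈ Set.Icc (0 : ℝ) 1, s * H s = G s - p + s * p
  pgf_eq : ∀ s ∈ Set.Icc (0 : ℝ) 1, G s = Real.exp (α * (s - 1)) * ((1 + H s) / 2) ^ 2

/-- The square root of the radicand, with the sign that makes the solution of the quadratic equation
for the generating function correct. -/
noncomputable def signedRoot (α : ℝ) (H : ℝ → ℝ) (s : ℝ) : ℝ :=
  (1 + H s) / 2 * Real.exp (α * (s - 1)) - s

namespace IsVisitPGF

variable {α p s : ℝ} {G H : ℝ → ℝ}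

lemma exp_div_four_lt (h : IsVisitPGF α p G H) : Real.exp (-α) / 4 < p := by
  have h0 : (0 : ℝ) ∈ Set.Icc (0 : ℝ) 1 := ⟨le_rfl, zero_le_one⟩
  have h1 := h.shift_eq 0 h0
  have h2 := h.pgf_eq 0 h0
  have h3 := h.pgf_le 0 h0
  have h4 := h.pgf_nonneg 0 h0
  have hE := Real.exp_pos (-α)
  rw [show α * (0 - 1) = -α by ring] at h2
  have h5 : p = G 0 := by linarith
  have h6 : 0 < G 0 := by rw [h2]; have := h4.trans h3; positivity
  rw [h5, h2]
  nlinarith [mul_pos hE (h6.trans_le h3)]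

lemma pos (h : IsVisitPGF α p G H) : 0 < p :=
  (by positivity : 0 < Real.exp (-α) / 4).trans h.exp_div_four_lt

lemma sq_signedRoot (h : IsVisitPGF α p G H) (hs : s ∈ Set.Icc (0 : ℝ) 1) :
    signedRoot α H s ^ 2 = radicand α p s := by
  have h1 := h.shift_eq s hs
  have h2 := h.pgf_eq s hs
  simp only [signedRoot, radicand]
  linear_combination Real.exp (α * (s - 1)) * (-h2) - Real.exp (α * (s - 1)) * h1

lemma pgf_eq_signedRoot (h : IsVisitPGF α p G H) (hs : s ∈ Set.Icc (0 : ℝ) 1) :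
    G s = p - s * (1 + p) + 2 * s ^ 2 * Real.exp (α * (1 - s)) +
      2 * s * Real.exp (α * (1 - s)) * signedRoot α H s := by
  have h1 := h.shift_eq s hs
  have h2 : Real.exp (α * (1 - s)) * Real.exp (α * (s - 1)) = 1 := by
    rw [← Real.exp_add, ← Real.exp_zero]; congr 1; ring
  simp only [signedRoot]
  linear_combination -h1 - s * (1 + H s) * h2

lemma radicand_nonneg (h : IsVisitPGF α p G H) : ∀ s ∈ Set.Icc (0 : ℝ) 1, 0 ≤ radicand α p s :=
  fun _ hs => h.sq_signedRoot hs ▸ sq_nonneg _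

lemma continuousOn_signedRoot (h : IsVisitPGF α p G H) :
    ContinuousOn (signedRoot α H) (Set.Icc 0 1) := by
  have : Continuous fun s : ℝ => Real.exp (α * (s - 1)) := by fun_prop
  exact (((h.continuousOn.const_add 1).div_const 2).mul this.continuousOn).sub continuousOn_id

lemma signedRoot_zero_pos (h : IsVisitPGF α p G H) : 0 < signedRoot α H 0 := by
  have h0 : (0 : ℝ) ∈ Set.Icc (0 : ℝ) 1 := ⟨le_rfl, zero_le_one⟩
  have := (h.pgf_nonneg 0 h0).trans (h.pgf_le 0 h0)
  simp only [signedRoot, sub_zero]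
  positivity

lemma exp_le_one (h : IsVisitPGF α p G H) (hs : s ∈ Set.Icc (0 : ℝ) 1) :
    Real.exp (α * (s - 1)) ≤ 1 :=
  Real.exp_le_one_iff.2 (mul_nonpos_of_nonneg_of_nonpos h.nonneg (by linarith [hs.2]))

lemma signedRoot_le (h : IsVisitPGF α p G H) (hs : s ∈ Set.Icc (0 : ℝ) 1) :
    signedRoot α H s ≤ 1 - s := by
  have h1 := h.shift_le_one s hs
  have h2 : (1 + H s) / 2 * Real.exp (α * (s - 1)) ≤ 1 :=
    mul_le_one₀ (by linarith) (Real.exp_pos _).le (h.exp_le_one hs)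
  simp only [signedRoot]
  linarith

lemma one_sub_le (h : IsVisitPGF α p G H) : 1 - α ≤ p :=
  one_sub_le_of_radicand_nonneg h.radicand_nonneg

/-- For `p > 1 - α` the root takes negative values near `1`: it is at most `1 - s`, while its
square is of first order. -/
lemma frequently_signedRoot_neg (h : IsVisitPGF α p G H) (hp : 1 - α < p) :
    ∀ r ∈ Set.Ico (0 : ℝ) 1, ∃ t ∈ Set.Ioo r 1, signedRoot α H t < 0 := by
  intro r hr
  by_contra! hge
  refine absurd (le_one_sub_of_radicand_le (α := α) (p := p) (C := 1) ?_) (not_le.2 hp)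
  refine Eventually.frequently ?_
  filter_upwards [Ioo_mem_nhdsLT hr.2] with s hs
  have hs' : s ∈ Set.Icc (0 : ℝ) 1 := ⟨hr.1.trans hs.1.le, hs.2.le⟩
  rw [← h.sq_signedRoot hs', one_mul]
  exact pow_le_pow_left₀ (hge s hs) (h.signedRoot_le hs') 2

lemma exists_zero (h : IsVisitPGF α p G H) {x y : ℝ} (hx : 0 ≤ x) (hxy : x ≤ y) (hy : y < 1)
    (hfx : 0 ≤ signedRoot α H x) (hfy : signedRoot α H y ≤ 0) :
    ∃ s ∈ Set.Icc x y, signedRoot α H s = 0 :=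
  intermediate_value_Icc' hxy
    (h.continuousOn_signedRoot.mono (Set.Icc_subset_Icc hx hy.le)) ⟨hfy, hfx⟩

lemma pos_of_one_sub_lt (h : IsVisitPGF α p G H) (hp : 1 - α < p) : 0 < α := by
  linarith [h.le_one]

/-- For `p > 1 - α` the root changes its sign in `(0, 1)`, from positive at `0` to negative. -/
lemma exists_interior_zero (h : IsVisitPGF α p G H) (hp : 1 - α < p) :
    ∃ s ∈ Set.Ioo (0 : ℝ) 1, signedRoot α H s = 0 := by
  obtain ⟨t, ht, hneg⟩ := h.frequently_signedRoot_neg hp 0 ⟨le_rfl, one_pos⟩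
  obtain ⟨s, hs, h0⟩ := h.exists_zero le_rfl ht.1.le ht.2 h.signedRoot_zero_pos.le hneg.le
  refine ⟨s, ⟨lt_of_le_of_ne hs.1 ?_, hs.2.trans_lt ht.2⟩, h0⟩
  rintro rfl
  exact h.signedRoot_zero_pos.ne' h0

lemma radicand_eq_zero (h : IsVisitPGF α p G H) (hs : s ∈ Set.Icc (0 : ℝ) 1)
    (h0 : signedRoot α H s = 0) : radicand α p s = 0 := by
  rw [← h.sq_signedRoot hs, h0]; ring

lemma eq_switchPoint_of_zero (h : IsVisitPGF α p G H) (hp : 1 - α < p)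
    (hs : s ∈ Set.Ioo (0 : ℝ) 1) (h0 : signedRoot α H s = 0) : s = switchPoint α p :=
  (eq_switchPoint h.pos (h.pos_of_one_sub_lt hp) hp h.radicand_nonneg hs
    (h.radicand_eq_zero ⟨hs.1.le, hs.2.le⟩ h0)).1

lemma switchPoint_mem (h : IsVisitPGF α p G H) (hp : 1 - α < p) :
    switchPoint α p ∈ Set.Ioo (0 : ℝ) 1 := by
  obtain ⟨s, hs, h0⟩ := h.exists_interior_zero hp
  exact h.eq_switchPoint_of_zero hp hs h0 ▸ hs

lemma switchDiscrim_pos (h : IsVisitPGF α p G H) (hp : 1 - α < p) : 0 < switchDiscrim α p := by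
  obtain ⟨s, hs, h0⟩ := h.exists_interior_zero hp
  exact (eq_switchPoint h.pos (h.pos_of_one_sub_lt hp) hp h.radicand_nonneg hs
    (h.radicand_eq_zero ⟨hs.1.le, hs.2.le⟩ h0)).2

lemma two_sub_sqrt_two_lt_and_lt_upperBound (h : IsVisitPGF α p G H) (hp : 1 - α < p) :
    2 - √2 < α ∧ p < upperBound α := by
  obtain ⟨s, hs, h0⟩ := h.exists_interior_zero hp
  exact lt_upperBound h.pos (h.pos_of_one_sub_lt hp) hp h.radicand_nonneg hs
    (h.radicand_eq_zero ⟨hs.1.le, hs.2.le⟩ h0)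

lemma signedRoot_eq_of_le (h : IsVisitPGF α p G H) (hp : 1 - α < p) (hs0 : 0 ≤ s)
    (hs : s ≤ switchPoint α p) : signedRoot α H s = √(radicand α p s) := by
  have hm := h.switchPoint_mem hp
  have hs' : s ∈ Set.Icc (0 : ℝ) 1 := ⟨hs0, hs.trans hm.2.le⟩
  rw [← h.sq_signedRoot hs', Real.sqrt_sq]
  by_contra! hneg
  obtain ⟨t, ht, h0⟩ := h.exists_zero le_rfl hs0 (hs.trans_lt hm.2) h.signedRoot_zero_pos.le
    hneg.le
  have ht0 : 0 < t := lt_of_le_of_ne ht.1 (by rintro rfl; exact h.signedRoot_zero_pos.ne' h0)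
  have := h.eq_switchPoint_of_zero hp ⟨ht0, (ht.2.trans hs).trans_lt hm.2⟩ h0
  have hst : s = t := le_antisymm (hs.trans this.ge) ht.2
  rw [hst, h0] at hneg
  exact lt_irrefl _ hneg

lemma signedRoot_eq_of_lt (h : IsVisitPGF α p G H) (hp : 1 - α < p)
    (hs : switchPoint α p < s) (hs1 : s ≤ 1) : signedRoot α H s = -√(radicand α p s) := by
  have hm := h.switchPoint_mem hp
  have hs' : s ∈ Set.Icc (0 : ℝ) 1 := ⟨hm.1.le.trans hs.le, hs1⟩
  rw [← h.sq_signedRoot hs', ← neg_sq, Real.sqrt_sq, neg_neg]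
  rw [neg_nonneg]
  rcases hs1.eq_or_lt with rfl | hs1
  · refine (pow_eq_zero_iff (n := 2) two_ne_zero).1 ?_ |>.le
    rw [h.sq_signedRoot hs', radicand_one]
  by_contra! hpos
  obtain ⟨y, hy, hneg⟩ := h.frequently_signedRoot_neg hp s ⟨hs'.1, hs1⟩
  obtain ⟨t, ht, h0⟩ := h.exists_zero hs'.1 hy.1.le hy.2 hpos.le hneg.le
  have := h.eq_switchPoint_of_zero hp
    ⟨hm.1.trans (hs.trans_le ht.1), ht.2.trans_lt hy.2⟩ h0
  linarith [ht.1]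

lemma eq_one_sub (h : IsVisitPGF α p G H) (hα : α ≤ 2 - √2) : p = 1 - α := by
  refine le_antisymm ?_ h.one_sub_le
  by_contra! hp
  exact absurd hα (not_le.2 (h.two_sub_sqrt_two_lt_and_lt_upperBound hp).1)

/-- In the subcritical and critical phases the root keeps its sign. -/
lemma signedRoot_eq_of_le_two_sub (h : IsVisitPGF α p G H) (hα : α ≤ 2 - √2)
    (hs : s ∈ Set.Icc (0 : ℝ) 1) : signedRoot α H s = √(radicand α p s) := by
  rw [← h.sq_signedRoot hs, Real.sqrt_sq]
  rcases hs.2.eq_or_lt with rfl | hs1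
  · refine (pow_eq_zero_iff (n := 2) two_ne_zero).1 ?_ |>.ge
    rw [h.sq_signedRoot hs, radicand_one]
  by_contra! hneg
  obtain ⟨t, ht, h0⟩ := h.exists_zero le_rfl hs.1 hs1 h.signedRoot_zero_pos.le hneg.le
  have ht0 : 0 < t := lt_of_le_of_ne ht.1 (by rintro rfl; exact h.signedRoot_zero_pos.ne' h0)
  have ht1 : t < 1 := ht.2.trans_lt hs1
  have hq := (switchPoly_eq_zero h.radicand_nonneg ⟨ht0, ht1⟩
    (h.radicand_eq_zero ⟨ht0.le, ht1.le⟩ h0)).1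
  have hp := h.eq_one_sub hα
  rw [hp] at hq
  -- `1` is a root of the polynomial, so `t` is its other root
  have h1 : (1 - t) * (2 * (1 - α) - α * (2 - α) * t) = 0 := by
    simp only [switchPoly] at hq
    linear_combination hq
  have h2 : 2 * (1 - α) - α * (2 - α) * t = 0 :=
    (mul_eq_zero.1 h1).resolve_left (by linarith)
  have hp0 := h.pos
  have hα0 := h.nonneg
  have h3 : α ^ 2 - 4 * α + 2 < 0 := by
    have h4 : α ≠ 0 := by rintro rfl; norm_num at h2
    have h5 : 0 < α * (2 - α) := mul_pos (lt_of_le_of_ne hα0 h4.symm) (by linarith)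
    nlinarith [mul_lt_mul_of_pos_left ht1 h5]
  exact absurd hα (not_le.2 (two_sub_sqrt_two_lt h3))

/-- In the supercritical phase `p = 1 - α` is impossible, because it would make the radicand
negative near `1`. -/
lemma one_sub_lt (h : IsVisitPGF α p G H) (hα : 2 - √2 < α) : 1 - α < p := by
  refine lt_of_le_of_ne h.one_sub_le fun hp => ?_
  have hp0 := h.pos
  have hr : (√2 : ℝ) ^ 2 = 2 := Real.sq_sqrt (by norm_num)
  have hr1 : (1 : ℝ) < √2 := Real.lt_sqrt_of_sq_lt (by norm_num)
  have h1 : 0 ≤ (α ^ 2 - 4 * α + 2) / 2 := by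
    refine ge_of_tendsto (tendsto_radicand_div_sq α) ?_
    filter_upwards [Ioo_mem_nhdsLT (show (0 : ℝ) < 1 by norm_num)] with s hs
    have := h.radicand_nonneg s ⟨hs.1.le, hs.2.le⟩
    rw [← hp] at this
    positivity
  nlinarith

/-- In the supercritical phase `1 - G s` is not of first order at `1`. -/
lemma not_one_sub_pgf_le (h : IsVisitPGF α p G H) (hα : 2 - √2 < α) (C : ℝ) :
    ¬ ∀ s ∈ Set.Icc (0 : ℝ) 1, 1 - G s ≤ C * (1 - s) := by
  intro hC
  refine absurd (le_one_sub_of_radicand_le (α := α) (p := p) (C := (1 + |C / 2 + α|) ^ 2) ?_)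
    (not_le.2 (h.one_sub_lt hα))
  refine Eventually.frequently ?_
  filter_upwards [Ioo_mem_nhdsLT (show (0 : ℝ) < 1 by norm_num)] with s hs
  have hs' : s ∈ Set.Icc (0 : ℝ) 1 := ⟨hs.1.le, hs.2.le⟩
  have hs1 : 0 < 1 - s := sub_pos.2 hs.2
  rw [← h.sq_signedRoot hs', ← mul_pow, sq_le_sq, abs_of_nonneg (a := _ * _) (by positivity),
    abs_le]
  constructor
  -- `1 - s - F s` is a sum of two terms of first order, by `H ≥ G` and `1 - e^{-x} ≤ x`
  · have h1 := hC s hs'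
    have h2 := h.pgf_le s hs'
    have h3 := h.shift_le_one s hs'
    have h4 : 1 - α * (1 - s) ≤ Real.exp (α * (s - 1)) := by
      linarith [Real.add_one_le_exp (α * (s - 1))]
    have h5 := h.exp_le_one hs'
    have h6 : (1 + H s) / 2 ≤ 1 := by linarith
    have h7 : 1 - (1 + H s) / 2 * Real.exp (α * (s - 1)) ≤ (C / 2 + α) * (1 - s) := by
      have h8 : 0 ≤ (1 - Real.exp (α * (s - 1))) * (1 - (1 + H s) / 2) :=
        mul_nonneg (by linarith) (by linarith)
      nlinarith
    have h9 : (C / 2 + α) * (1 - s) ≤ |C / 2 + α| * (1 - s) :=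
      mul_le_mul_of_nonneg_right (le_abs_self _) hs1.le
    simp only [signedRoot]
    nlinarith
  · have h1 := h.signedRoot_le hs'
    have h2 : 0 ≤ |C / 2 + α| * (1 - s) := by positivity
    nlinarith

/-- In the subcritical and critical phases `1 - G s` has a finite slope at `1`. -/
lemma tendsto_one_sub_pgf_div (h : IsVisitPGF α p G H) (hα : α ≤ 2 - √2) :
    Tendsto (fun s => (1 - G s) / (1 - s)) (𝓝[<] 1)
      (𝓝 (2 - α - √(2 * (α ^ 2 - 4 * α + 2)))) := by
  have hp := h.eq_one_sub hα
  have h1 := (Real.continuous_sqrt.tendsto _).comp (tendsto_radicand_div_sq α)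
  have hE : Continuous fun s : ℝ => 2 * s * Real.exp (α * (1 - s)) := by fun_prop
  have hE1 := (hE.tendsto 1).mono_left (nhdsWithin_le_nhds (s := Set.Iio 1))
  have hd : HasDerivAt (fun s : ℝ => (1 - α) - s * (1 + (1 - α)) +
      2 * s ^ 2 * Real.exp (α * (1 - s))) (2 - α) 1 := by
    have e1 : HasDerivAt (fun s : ℝ => α * (1 - s)) (-α) 1 := by
      simpa using ((hasDerivAt_id (1 : ℝ)).const_sub 1).const_mul α
    have e2 := (((hasDerivAt_id (1 : ℝ)).mul_const (1 + (1 - α))).const_sub (1 - α)).add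
      (((hasDerivAt_pow 2 (1 : ℝ)).const_mul 2).mul e1.exp)
    refine e2.congr_deriv ?_
    simp
    ring
  have hs := (hasDerivWithinAt_iff_tendsto_slope' (s := Set.Iio (1 : ℝ)) (by simp)).1
    hd.hasDerivWithinAt
  have hlim := hs.sub (hE1.mul h1)
  have hval : 2 - α - 2 * 1 * Real.exp (α * (1 - 1)) * √((α ^ 2 - 4 * α + 2) / 2) =
      2 - α - √(2 * (α ^ 2 - 4 * α + 2)) := by
    rw [show 2 * (α ^ 2 - 4 * α + 2) = 2 ^ 2 * ((α ^ 2 - 4 * α + 2) / 2) by ring,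
      Real.sqrt_mul (by norm_num), Real.sqrt_sq (by norm_num)]
    simp
  rw [hval] at hlim
  refine hlim.congr' ?_
  filter_upwards [Ioo_mem_nhdsLT (show (0 : ℝ) < 1 by norm_num)] with s hs
  have hs' : s ∈ Set.Icc (0 : ℝ) 1 := ⟨hs.1.le, hs.2.le⟩
  have hs1 : 0 < 1 - s := sub_pos.2 hs.2
  have hs2 : s - 1 ≠ 0 := by linarith
  rw [h.pgf_eq_signedRoot hs', h.signedRoot_eq_of_le_two_sub hα hs', hp, slope_def_field,
    Function.comp_apply, Real.sqrt_div' _ (by positivity), Real.sqrt_sq hs1.le]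
  simp only [sub_self, mul_zero, Real.exp_zero]
  have e : s - 1 = -(1 - s) := by ring
  rw [e]
  field_simp
  ring

end IsVisitPGF

/-! ### The mean of a random variable from its generating function -/

section Mean

variable {Ω : Type*} [MeasurableSpace Ω] {μ : Measure Ω} [IsProbabilityMeasure μ] {X : Ω → ℕ}

lemma integrable_pow_of_mem_Icc (hX : AEMeasurable X μ) (φ : ℕ → ℕ) {s : ℝ}
    (hs : s ∈ Set.Icc (0 : ℝ) 1) : Integrable (fun ω => s ^ φ (X ω)) μ :=
  Integrable.of_bound
    ((Measurable.of_discrete (f := fun k : ℕ => s ^ φ k)).comp_aemeasurable hX).aestronglyMeasurable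
    1 (ae_of_all _ fun _ => abs_pow_le_one hs _)

/-- `E[X]` is the limit of `(1 - E[s ^ X]) / (1 - s)`, by monotone convergence of
`(1 - s ^ X) / (1 - s) = 1 + s + ⋯ + s ^ (X - 1)`. -/
lemma lintegral_eq_of_tendsto (hX : AEMeasurable X μ) {l : ℝ}
    (h : Tendsto (fun s : ℝ => (1 - ∫ ω, s ^ X ω ∂μ) / (1 - s)) (𝓝[<] 1) (𝓝 l)) :
    ∫⁻ ω, (X ω : ENNReal) ∂μ = ENNReal.ofReal l := by
  let r : ℕ → ℝ := fun k => 1 - 1 / ((k : ℝ) + 1)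
  have hr : ∀ k, r k ∈ Set.Ico (0 : ℝ) 1 := by
    intro k
    have h1 : (0 : ℝ) < 1 / ((k : ℝ) + 1) := Nat.one_div_pos_of_nat
    have h2 : 1 / ((k : ℝ) + 1) ≤ 1 := by
      rw [div_le_one (by positivity)]; linarith [(Nat.cast_nonneg k : (0 : ℝ) ≤ k)]
    exact ⟨by simp only [r]; linarith, by simp only [r]; linarith⟩
  have hmono : Monotone r := fun i j hij => by
    simp only [r]
    gcongr
  have hr1 : Tendsto r atTop (𝓝 1) := by
    simpa [r] using (tendsto_one_div_add_atTop_nhds_zero_nat (𝕜 := ℝ)).const_sub 1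
  have hr2 : Tendsto r atTop (𝓝[<] 1) :=
    tendsto_nhdsWithin_iff.2 ⟨hr1, Eventually.of_forall fun k => (hr k).2⟩
  have hf : ∀ (k : ℕ) (n : ℕ), ∑ i ∈ Finset.range n, r k ^ i = (1 - r k ^ n) / (1 - r k) := by
    intro k n
    rw [eq_div_iff (by linarith [(hr k).2]), mul_comm, mul_neg_geom_sum]
  have hlint := lintegral_tendsto_of_tendsto_of_monotone (μ := μ)
    (f := fun k ω => ENNReal.ofReal (∑ i ∈ Finset.range (X ω), r k ^ i))
    (F := fun ω => (X ω : ENNReal))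
    (fun k => (Measurable.of_discrete (f := fun n : ℕ =>
      ENNReal.ofReal (∑ i ∈ Finset.range n, r k ^ i))).comp_aemeasurable hX)
    (ae_of_all _ fun ω i j hij => ENNReal.ofReal_le_ofReal <| Finset.sum_le_sum fun m _ =>
      pow_le_pow_left₀ (hr i).1 (hmono hij) m)
    (ae_of_all _ fun ω => by
      have hc : Continuous fun s : ℝ => ENNReal.ofReal (∑ i ∈ Finset.range (X ω), s ^ i) :=
        ENNReal.continuous_ofReal.comp (by fun_prop)
      have := (hc.tendsto 1).comp hr1
      simpa [Function.comp_def] using this)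
  have hlim : Tendsto (fun k => ENNReal.ofReal ((1 - ∫ ω, r k ^ X ω ∂μ) / (1 - r k))) atTop
      (𝓝 (ENNReal.ofReal l)) := (ENNReal.continuous_ofReal.tendsto l).comp (h.comp hr2)
  refine tendsto_nhds_unique hlint (hlim.congr fun k => ?_)
  have hi : Integrable (fun ω => r k ^ X ω) μ :=
    integrable_pow_of_mem_Icc hX id (Set.Ico_subset_Icc_self (hr k))
  have hi2 : Integrable (fun ω => ∑ i ∈ Finset.range (X ω), r k ^ i) μ := by
    simp only [hf]
    exact ((integrable_const 1).sub hi).div_const _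
  rw [← ofReal_integral_eq_lintegral_ofReal hi2
    (ae_of_all _ fun ω => Finset.sum_nonneg fun i _ => pow_nonneg (hr k).1 i)]
  simp only [hf]
  rw [integral_div, integral_sub (integrable_const 1) hi]
  simp

/-- If `E[X]` is finite, then `1 - E[s ^ X] ≤ E[X] (1 - s)`. -/
lemma one_sub_integral_pow_le (hX : AEMeasurable X μ) (hfin : ∫⁻ ω, (X ω : ENNReal) ∂μ ≠ ⊤) {s : ℝ}
    (hs : s ∈ Set.Icc (0 : ℝ) 1) :
    1 - ∫ ω, s ^ X ω ∂μ ≤ (∫ ω, (X ω : ℝ) ∂μ) * (1 - s) := by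
  have hm : AEStronglyMeasurable (fun ω => (X ω : ℝ)) μ :=
    (Measurable.of_discrete.comp_aemeasurable hX).aestronglyMeasurable
  have hXi : Integrable (fun ω => (X ω : ℝ)) μ := by
    refine ⟨hm, ?_⟩
    rw [hasFiniteIntegral_iff_norm]
    simpa using hfin.lt_top
  have hi : Integrable (fun ω => s ^ X ω) μ := integrable_pow_of_mem_Icc hX id hs
  have h1 : ∫ ω, (1 - s ^ X ω) ∂μ = 1 - ∫ ω, s ^ X ω ∂μ := by
    rw [integral_sub (integrable_const 1) hi]; simp
  rw [← h1, ← integral_mul_const]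
  refine integral_mono ((integrable_const 1).sub hi) (hXi.mul_const _) fun ω => ?_
  have := one_add_mul_sub_le_pow (a := s) (by linarith [hs.1]) (X ω)
  simp only
  linarith

/-- A recursive equation for the generating function, as for the visits to the root, yields the
properties collected in `IsVisitPGF`. -/
lemma isVisitPGF_of_integral_pow_eq {α : ℝ} (hα : 0 ≤ α) (hX : AEMeasurable X μ)
    (h : ∀ s ∈ Set.Icc (0 : ℝ) 1, ∫ ω, s ^ X ω ∂μ =
      Real.exp (α * (s - 1)) * ((1 + ∫ ω, s ^ (X ω - 1) ∂μ) / 2) ^ 2) :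
    IsVisitPGF α (μ.real {ω | X ω = 0}) (fun s => ∫ ω, s ^ X ω ∂μ)
      (fun s => ∫ ω, s ^ (X ω - 1) ∂μ) := by
  have hms : NullMeasurableSet {ω | X ω = 0} μ :=
    hX.nullMeasurableSet_preimage (measurableSet_singleton 0)
  have hind : ∫ ω, {ω | X ω = 0}.indicator (1 : Ω → ℝ) ω ∂μ = μ.real {ω | X ω = 0} := by
    rw [integral_indicator₀ hms]; simp
  have hindi : Integrable ({ω | X ω = 0}.indicator (1 : Ω → ℝ)) μ :=
    (integrable_const (1 : ℝ)).indicator₀ hms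
  refine ⟨hα, measureReal_le_one, ?_, ?_, ?_, ?_, ?_, h⟩
  · refine continuousOn_of_dominated (bound := fun _ => 1) (fun s hs => ?_) (fun s hs => ?_)
      (integrable_const 1) (ae_of_all _ fun ω => by fun_prop)
    · exact (integrable_pow_of_mem_Icc hX (· - 1) hs).aestronglyMeasurable
    · exact ae_of_all _ fun ω => abs_pow_le_one hs _
  · exact fun s hs => integral_nonneg fun ω => pow_nonneg hs.1 _
  · exact fun s hs => integral_mono (integrable_pow_of_mem_Icc hX id hs)
      (integrable_pow_of_mem_Icc hX (· - 1) hs) fun ω =>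
        pow_le_pow_of_le_one hs.1 hs.2 (Nat.sub_le _ _)
  · intro s hs
    have := integral_mono (integrable_pow_of_mem_Icc hX (· - 1) hs) (integrable_const (1 : ℝ))
      fun ω => pow_le_one₀ hs.1 hs.2
    simpa using this
  · intro s hs
    have hpt : ∀ ω, s * s ^ (X ω - 1) =
        s ^ X ω - {ω | X ω = 0}.indicator (1 : Ω → ℝ) ω +
          s * {ω | X ω = 0}.indicator (1 : Ω → ℝ) ω := by
      intro ω
      by_cases h0 : X ω = 0
      · simp [h0]
      · simp [h0, mul_pow_sub_one h0]
    have hi : Integrable (fun ω => s ^ X ω) μ := integrable_pow_of_mem_Icc hX id hs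
    rw [← integral_const_mul]
    simp only [hpt]
    rw [integral_add (f := fun ω => s ^ X ω - {ω | X ω = 0}.indicator (1 : Ω → ℝ) ω)
      (hi.sub hindi) (hindi.const_mul s), integral_sub hi hindi,
      integral_const_mul, hind]

end Mean

theorem mainTheorem2 {Ω : Type*} [MeasurableSpace Ω]
    (μ : MeasureTheory.Measure Ω) [MeasureTheory.IsProbabilityMeasure μ]
    (α : NNReal)
    -- `N v` children and `A v` arriving cars at each vertex, all independent
    (N A : Vertex → Ω → ℕ)
    (hN : ∀ v, ProbabilityTheory.HasLaw (N v)
      (ProbabilityTheory.binomial 2 ⟨1 / 2, by norm_num, by norm_num⟩) μ)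
    (hA : ∀ v, ProbabilityTheory.HasLaw (A v) (ProbabilityTheory.poissonMeasure α) μ)
    (hindep : ProbabilityTheory.iIndepFun (Sum.elim N A) μ)
    -- the cars arrive one by one, in an arbitrary order
    (L : Ω → List Vertex)
    (hL : ∀ ω, (familyTree (fun v => N v ω)).Finite →
      IsArrivalSequence (familyTree (fun v => N v ω)) (fun v => A v ω) (L ω))
    (X : Ω → ℕ) (hX : ∀ ω, X ω = rootVisits (L ω))
    (p : ℝ) (hp : p = μ.real {ω | X ω = 0}) :
    AEMeasurable X μ ∧
    ((α : ℝ) ≤ 2 - √2 →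
      (∀ s ∈ Set.Icc (0 : ℝ) 1,
        0 ≤ s ^ 2 - Real.exp (α * (s - 1)) * (s * (2 - α) - (1 - α)) ∧
        ∫ ω, s ^ X ω ∂μ =
          1 - α - s * (2 - α) + 2 * s ^ 2 * Real.exp (α * (1 - s))
            + 2 * s * Real.exp (α * (1 - s))
              * √(s ^ 2 - Real.exp (α * (s - 1)) * (s * (2 - α) - (1 - α)))) ∧
      p = 1 - α ∧
      MeasureTheory.Integrable (fun ω => (X ω : ℝ)) μ ∧
      ∫ ω, (X ω : ℝ) ∂μ = 2 - α - √(2 * ((α : ℝ) ^ 2 - 4 * α + 2))) ∧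
    (2 - √2 < (α : ℝ) →
      0 ≤ switchDiscrim α p ∧
      switchPoint α p ∈ Set.Ioo (0 : ℝ) 1 ∧
      (∀ s ∈ Set.Icc (0 : ℝ) 1,
        0 ≤ radicand α p s ∧
        (s ≤ switchPoint α p →
          ∫ ω, s ^ X ω ∂μ =
            p - s * (1 + p) + 2 * s ^ 2 * Real.exp (α * (1 - s))
              + 2 * s * Real.exp (α * (1 - s)) * √(radicand α p s)) ∧
        (switchPoint α p < s →
          ∫ ω, s ^ X ω ∂μ =
            p - s * (1 + p) + 2 * s ^ 2 * Real.exp (α * (1 - s))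
              - 2 * s * Real.exp (α * (1 - s)) * √(radicand α p s))) ∧
      1 - α < p ∧
      ∫⁻ ω, (X ω : ENNReal) ∂μ = ⊤ ∧
      max (Real.exp (-α) / 4) (1 - α) < p ∧
      p < upperBound α) := by
  obtain ⟨hXm, hrec⟩ := integral_pow_eq hN hA hindep hL hX
  have h := isVisitPGF_of_integral_pow_eq α.coe_nonneg hXm hrec
  rw [← hp] at h
  refine ⟨hXm, fun hα => ?_, fun hα => ?_⟩
  · have hp1 := h.eq_one_sub hα
    have hrad : ∀ s : ℝ, s ^ 2 - Real.exp (α * (s - 1)) * (s * (2 - α) - (1 - α)) =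
        radicand α p s := by
      intro s; simp only [radicand, hp1]; ring_nf
    have hlim := h.tendsto_one_sub_pgf_div hα
    have hlint := lintegral_eq_of_tendsto hXm hlim
    have hl0 : 0 ≤ 2 - (α : ℝ) - √(2 * ((α : ℝ) ^ 2 - 4 * α + 2)) := by
      refine ge_of_tendsto hlim ?_
      filter_upwards [Ioo_mem_nhdsLT (show (0 : ℝ) < 1 by norm_num)] with s hs
      have hs' : s ∈ Set.Icc (0 : ℝ) 1 := ⟨hs.1.le, hs.2.le⟩
      exact div_nonneg (sub_nonneg.2 ((h.pgf_le s hs').trans (h.shift_le_one s hs')))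
        (by linarith [hs.2])
    have hm : AEStronglyMeasurable (fun ω => (X ω : ℝ)) μ :=
      (Measurable.of_discrete.comp_aemeasurable hXm).aestronglyMeasurable
    refine ⟨fun s hs => ?_, hp1, ⟨hm, ?_⟩, ?_⟩
    · rw [hrad]
      refine ⟨h.radicand_nonneg s hs, ?_⟩
      rw [h.pgf_eq_signedRoot hs, h.signedRoot_eq_of_le_two_sub hα hs, hp1]
      ring
    · rw [hasFiniteIntegral_iff_norm]
      simp [hlint]
    · rw [integral_eq_lintegral_of_nonneg_ae (ae_of_all _ fun ω => by positivity) hm]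
      simp only [ENNReal.ofReal_natCast, hlint, ENNReal.toReal_ofReal hl0]
  · have hp1 := h.one_sub_lt hα
    refine ⟨(h.switchDiscrim_pos hp1).le, h.switchPoint_mem hp1, fun s hs =>
      ⟨h.radicand_nonneg s hs, fun hle => ?_, fun hlt => ?_⟩, hp1, ?_,
      max_lt h.exp_div_four_lt hp1, (h.two_sub_sqrt_two_lt_and_lt_upperBound hp1).2⟩
    · rw [h.pgf_eq_signedRoot hs, h.signedRoot_eq_of_le hp1 hs.1 hle]
    · rw [h.pgf_eq_signedRoot hs, h.signedRoot_eq_of_lt hp1 hlt hs.2]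
      ring
    · by_contra hfin
      exact h.not_one_sub_pgf_le hα _ fun s hs => one_sub_integral_pow_le hXm hfin hs
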